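/- **Theorem 3 (convergence of the modified truncated $\tau$-leaping sampler for masking diffusion).** *Setting.* Let $d\ge 0$, $S\ge 1$, $\mathcal X=([S]\cup\{\mathrm{MASK}\})^d$, and let $q_{\mathrm{data}}=q_0$ be a probability distribution on $[S]^d\subset\mathcal X$. The masking noising process $(x_t)_{t\ge0}$ is the time-homogeneous continuous-time Markov chain on $\mathcal X$ with $x_0\sim q_{\mathrm{data}}$ whose rate matrix is $Q(x,y)=1$ if $x$ and $y$ differ in exactly one coordinate $i$, $x^i\ne\mathrm{MASK}$ and $y^i=\mathrm{MASK}$; $Q(x,y)=0$ for all other $x\ne y$; and $Q(x,x)=-\sum_{y\ne x}Q(x,y)$. Let $q_t$ be its marginal at time $t$ (so $q_t=q_0e^{tQ}$) and $s_t(y,x)=q_t(y)/q_t(x)$ the score. For $\widehat s:\mathcal X\times\mathcal X\to[0,\infty)$ the score entropy loss is $$\mathcal L_{\mathrm{SE}}(t,\widehat s,s_t)=\mathbb E_{x\sim q_t}\sum_{y\ne x}Q(y,x)\,s_t(y,x)\,D(\widehat s(y,x),s_t(y,x)),\qquad D(a,b)=\tfrac ab-1-\log\tfrac ab,$$ where $b\,D(a,b)=a-b-b\log(a/b)$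 is read as $a$ if $b=0$ and as $+\infty$ if $a=0<b$. Let $$\mathcal I(t)=\sum_{i\ne j}\mathrm I\big(x_t^i;x_t^j\mid x_t^{-(i,j)}\big),\qquad x_t\sim q_t,$$ where the sum is over ordered pairs in $[d]$, $\mathrm I(\cdot;\cdot\mid\cdot)$ is conditional mutual information, and $x^{-(i,j)}$ is the collection of all unmasked coordinates of $x$ (with their positions) other than the $i$-th and the $j$-th. *Algorithm.* Fix $N\ge1$, a grid $0=t_0<t_1<\dots<t_N=T$ with steps $h_k=t_{k+1}-t_k$, and score estimates $\widehat s_{T-t_k}:\mathcal X\times\mathcal X\to[0,\infty)$ for $0\le k<N$. Draw $x_{t_0}$ from $$p_0=\Big((1-e^{-T})\,\delta_{\mathrm{MASK}}+S^{-1}e^{-T}\sum_{a=1}^S\delta_a\Big)^{\otimes d}.$$ For $k=0,\dots,N-1$, given $x=x_{t_k}$, update the coordinates independently: every unmasked coordinate is kept; for a masked coordinate $i$, put $\widehat Q(a)=\widehat s_{T-t_k}(x\odot_i a,x)$ for $a\in[S]$, where $x\odot_i a$ is $x$ with its $i$-th coordinate replaced by $a$, and $$P=\exp\Big(-\Delta_k\sum_{a\in[S]}\widehat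 Q(a)\Big),\quad \Delta_k=(e^{T-t_k}-1)\log\frac{e^T-e^{t_k}}{e^T-e^{t_{k+1}}}\quad\text{if }k<N-1,\qquad P=0\quad\text{if }k=N-1;$$ then $x_{t_{k+1}}^i$ is $\mathrm{MASK}$ with probability $P$ and $a\in[S]$ with probability $(1-P)\,\widehat Q(a)/\sum_b\widehat Q(b)$ (with $1/S$ in place of the ratio if all $\widehat Q(b)$ vanish). Let $p_{\mathrm{output}}$ be the law of $x_{t_N}$. *Claim.* For every $\Delta_0$ there is a constant $C>0$ depending only on $\Delta_0$ such that, for all $d,S,q_{\mathrm{data}},N,(t_k),(\widehat s_{T-t_k})$ as above and all $\varepsilon_{\mathrm{score}}\ge0$ with $\max_k h_k\le\Delta_0$ and $$\sum_{k=0}^{N-1}h_k\,\mathcal L_{\mathrm{SE}}(T-t_k,\widehat s_{T-t_k},s_{T-t_k})\le\varepsilon_{\mathrm{score}},$$ the function $\mathcal I$ is integrable on each $[T-t_{k+1},T-t_k]$ and $$\mathsf{KL}(q_{\mathrm{data}}\,\|\,p_{\mathrm{output}})\le C\Big(\varepsilon_{\mathrm{score}}+e^{-T}d\log S+\sum_{k=0}^{N-1}h_k\int_{T-t_{k+1}}^{T-t_k}\mathcal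 I(t)\,dt\Big).$$ -/

import Mathlib

open scoped ENNReal NNReal

noncomputable section

namespace MaskingDiffusion

/-! ### State space -/

/-- The one-coordinate alphabet `[S] ∪ {MASK}`; `none` is `MASK`, `some a` is the token `a`. -/
abbrev Token (S : ℕ) : Type := Option (Fin S)

/-- The state space `([S] ∪ {MASK})^d`. -/
abbrev State (d S : ℕ) : Type := Fin d → Token S

/-- `x ⊙_i c`: the vector `x` with its `i`-th coordinate replaced by `c`. -/
def setCoord {d S : ℕ} (x : State d S) (i : Fin d) (c : Token S) : State d S :=
  Function.update x i c

/-- The data law on `[S]^d`, viewed as a law on `([S] ∪ {MASK})^d`. -/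
def embedData {d S : ℕ} (qdata : PMF (Fin d → Fin S)) : PMF (State d S) :=
  qdata.map fun x i => some (x i)

/-! ### The masking noising process -/

/-- Off-diagonal one-coordinate rates: an unmasked token is masked at rate one. -/
def tokRate {S : ℕ} (a b : Token S) : ℝ :=
  if a ≠ none ∧ b = none then 1 else 0

/-- Off-diagonal rates: `Q(x, y)` is the one-coordinate rate of the coordinate in which `x` and `y`
differ when they differ in exactly one coordinate, and `0` otherwise. (`tokRate a a = 0`, so the
sum has at most one nonzero term.) -/
def offDiagRate {d S : ℕ} (x y : State d S) : ℝ :=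
  if hammingDist x y = 1 then ∑ i, tokRate (x i) (y i) else 0

/-- The rate matrix of the masking noising process. -/
def rateMatrix (d S : ℕ) : Matrix (State d S) (State d S) ℝ := fun x y =>
  if x = y then -∑ z ∈ Finset.univ.erase x, offDiagRate x z else offDiagRate x y

/-- The marginal p.m.f. `q_t` of the masking process started from the data: the solution
`q_t = q_0 exp(t Q)` of the Kolmogorov forward equation `dq_t/dt = Qᵀ q_t`. -/
def marginal {d S : ℕ} (qdata : PMF (Fin d → Fin S)) (t : ℝ) : State d S → ℝ :=
  Matrix.vecMul (fun x => (embedData qdata x).toReal) (NormedSpace.exp (t • rateMatrix d S))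

/-- The score `s_t(y, x) = q_t(y) / q_t(x)`. -/
def score {d S : ℕ} (qdata : PMF (Fin d → Fin S)) (t : ℝ) (y x : State d S) : ℝ :=
  marginal qdata t y / marginal qdata t x

/-! ### Score entropy loss -/

/-- The Bregman divergence `D(a, b) = a / b - 1 - log (a / b)`, for `a, b > 0`. -/
def bregman (a b : ℝ) : ℝ := a / b - 1 - Real.log (a / b)

/-- The product `b * D(a, b) = a - b - b log (a / b)` for `a, b ≥ 0`, with its boundary values:
it equals `a` when `b = 0` and `+∞` when `a = 0 < b`. -/
def weightedBregman (a b : ℝ) : ℝ≥0∞ :=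
  if b = 0 then ENNReal.ofReal a
  else if a = 0 then ⊤
  else ENNReal.ofReal (b * bregman a b)

/-- The score entropy loss
`E_{x ∼ q_t} ∑_{y ≠ x} Q(y, x) s_t(y, x) D(ŝ(y, x), s_t(y, x))` of an estimate `shat` of the score
at time `t`. -/
def scoreEntropyLoss {d S : ℕ} (qdata : PMF (Fin d → Fin S)) (t : ℝ)
    (shat : State d S → State d S → ℝ≥0) : ℝ≥0∞ :=
  ∑ x, ENNReal.ofReal (marginal qdata t x) *
    ∑ y ∈ Finset.univ.erase x, ENNReal.ofReal (rateMatrix d S y x) *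
      weightedBregman (shat y x) (score qdata t y x)

/-! ### Discretization -/

/-- A discretization `0 = t_0 < t_1 < ⋯ < t_N = T` with `N ≥ 1` steps
(the values `t k` for `k > N` play no role). -/
structure TimeGrid where
  N : ℕ
  N_pos : 0 < N
  t : ℕ → ℝ
  t_zero : t 0 = 0
  t_lt : ∀ k < N, t k < t (k + 1)

/-- The time horizon `T = t_N`. -/
def TimeGrid.T (g : TimeGrid) : ℝ := g.t g.N

/-- The step size `h_k = t_{k+1} - t_k`. -/
def TimeGrid.h (g : TimeGrid) (k : ℕ) : ℝ := g.t (k + 1) - g.t k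

theorem TimeGrid.t_le (g : TimeGrid) {j k : ℕ} (hjk : j ≤ k) (hk : k ≤ g.N) : g.t j ≤ g.t k := by
  induction k, hjk using Nat.le_induction with
  | base => exact le_rfl
  | succ k _ ih => exact (ih (by omega)).trans (g.t_lt k (by omega)).le

theorem TimeGrid.t_lt_T (g : TimeGrid) {k : ℕ} (hk : k < g.N) : g.t k < g.T :=
  (g.t_lt k hk).trans_le (g.t_le (by omega) le_rfl)

theorem TimeGrid.T_nonneg (g : TimeGrid) : 0 ≤ g.T := by
  have := g.t_le (Nat.zero_le g.N) le_rfl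
  rwa [g.t_zero] at this

/-- The aggregated score estimation error is at most `ε`:
`∑_k (t_{k+1} - t_k) L_SE(T - t_k, ŝ_{T - t_k}, s_{T - t_k}) ≤ ε`. -/
def ScoreErrorLE {d S : ℕ} (qdata : PMF (Fin d → Fin S)) (g : TimeGrid)
    (shat : ℝ → State d S → State d S → ℝ≥0) (ε : ℝ) : Prop :=
  ∑ k ∈ Finset.range g.N, ENNReal.ofReal (g.h k) *
    scoreEntropyLoss qdata (g.T - g.t k) (shat (g.T - g.t k)) ≤ ENNReal.ofReal ε

/-! ### The sampler -/

/-- The law of a vector with independent coordinates of laws `p i`. -/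
def prodLaw {d S : ℕ} (p : Fin d → PMF (Token S)) : PMF (State d S) :=
  PMF.ofFintype (fun y => ∏ i, p i (y i)) (by
    have h : ∀ i, ∑ a, p i a = 1 := fun i => by
      rw [← tsum_fintype (L := .unconditional _)]; exact (p i).tsum_coe
    rw [← Fintype.prod_sum (fun i a => p i a)]
    simp [h])

/-- The law on `[S] ∪ {MASK}` giving `MASK` mass `P` and `a ∈ [S]` mass `(1 - P) ν(a)`. -/
def maskMix {S : ℕ} (P : ℝ) (h0 : 0 ≤ P) (h1 : P ≤ 1) (ν : PMF (Fin S)) : PMF (Token S) :=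
  PMF.ofFintype
    (fun o => o.elim (ENNReal.ofReal P) fun a => ENNReal.ofReal (1 - P) * ν a) (by
      have h : ∑ a, ν a = 1 := by
        rw [← tsum_fintype (L := .unconditional _)]; exact ν.tsum_coe
      rw [Fintype.sum_option]
      simp only [Option.elim]
      rw [← Finset.mul_sum, h, mul_one, ← ENNReal.ofReal_add h0 (by linarith)]
      simp)

/-- The initial law `((1 - e^{-T}) δ_MASK + e^{-T} Unif([S]))^{⊗ d}`. -/
def initLaw (d S : ℕ) [NeZero S] (g : TimeGrid) : PMF (State d S) :=
  prodLaw fun _ => maskMix (1 - Real.exp (-g.T))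
    (by have := Real.exp_le_one_iff.2 (neg_nonpos.2 g.T_nonneg); linarith)
    (by have := Real.exp_pos (-g.T); linarith) (PMF.uniformOfFintype (Fin S))

/-- The law on `[S]` proportional to the rates `r`; uniform if all the rates vanish. -/
def tokenLaw {S : ℕ} [NeZero S] (r : Fin S → ℝ≥0) : PMF (Fin S) :=
  if h : ∑ b, r b = 0 then PMF.uniformOfFintype (Fin S)
  else PMF.ofFintype (fun a => ((r a / ∑ b, r b : ℝ≥0) : ℝ≥0∞)) (by
    rw [← ENNReal.ofNNReal_finsetSum, ← Finset.sum_div, div_self h, ENNReal.coe_one])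

/-- `Δ_k = (e^{T - t_k} - 1) log ((e^T - e^{t_k}) / (e^T - e^{t_{k+1}}))`. -/
def TimeGrid.Delta (g : TimeGrid) (k : ℕ) : ℝ :=
  (Real.exp (g.T - g.t k) - 1) *
    Real.log ((Real.exp g.T - Real.exp (g.t k)) / (Real.exp g.T - Real.exp (g.t (k + 1))))

theorem TimeGrid.Delta_nonneg (g : TimeGrid) {k : ℕ} (hk : k + 1 < g.N) : 0 ≤ g.Delta k := by
  have h1 := g.t_lt k (by omega)
  have h2 := g.t_lt_T hk
  have h3 := Real.exp_lt_exp.2 h2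
  have h4 := Real.exp_lt_exp.2 h1
  refine mul_nonneg ?_ (Real.log_nonneg ?_)
  · have := Real.one_le_exp (x := g.T - g.t k) (by linarith)
    linarith
  · rw [le_div_iff₀ (by linarith)]
    linarith

/-- The probability `P_k` that a masked coordinate with unmasking rates `r` stays masked in step
`k`: it is `exp (-(∑_a r a) Δ_k)` for `k < N - 1` and `0` in the last step. -/
def stayProb {S : ℕ} (g : TimeGrid) (k : ℕ) (r : Fin S → ℝ≥0) : ℝ :=
  if k + 1 < g.N then Real.exp (-(∑ a, (r a : ℝ)) * g.Delta k) else 0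

theorem stayProb_nonneg {S : ℕ} (g : TimeGrid) (k : ℕ) (r : Fin S → ℝ≥0) :
    0 ≤ stayProb g k r := by
  unfold stayProb
  split_ifs
  · exact (Real.exp_pos _).le
  · exact le_rfl

theorem stayProb_le_one {S : ℕ} (g : TimeGrid) (k : ℕ) (r : Fin S → ℝ≥0) :
    stayProb g k r ≤ 1 := by
  unfold stayProb
  split_ifs with h
  · rw [Real.exp_le_one_iff, neg_mul, neg_nonpos]
    exact mul_nonneg (Finset.sum_nonneg fun a _ => (r a).2) (g.Delta_nonneg h)
  · exact zero_le_one

/-- The estimated unmasking rates `a ↦ ŝ_{T - t_k}(x ⊙_i a, x)` of coordinate `i` at step `k`. -/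
def estRate {d S : ℕ} (g : TimeGrid) (shat : ℝ → State d S → State d S → ℝ≥0) (k : ℕ)
    (x : State d S) (i : Fin d) (a : Fin S) : ℝ≥0 :=
  shat (g.T - g.t k) (setCoord x i (some a)) x

/-- One step of the modified truncated `τ`-leaping algorithm: given `x = x_{t_k}`, the coordinates of
`x_{t_{k+1}}` are independent, unmasked coordinates do not change, and a masked coordinate stays
masked with probability `P_k` and otherwise becomes `a` with probability proportional to its
estimated rate. -/
def stepLaw {d S : ℕ} [NeZero S] (g : TimeGrid) (shat : ℝ → State d S → State d S → ℝ≥0) (k : ℕ)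
    (x : State d S) : PMF (State d S) :=
  prodLaw fun i =>
    if x i = none then
      maskMix (stayProb g k (estRate g shat k x i)) (stayProb_nonneg _ _ _) (stayProb_le_one _ _ _)
        (tokenLaw (estRate g shat k x i))
    else PMF.pure (x i)

/-- The law of `x_{t_k}` in the modified truncated `τ`-leaping algorithm started from `p0`. -/
def algLaw {d S : ℕ} [NeZero S] (g : TimeGrid) (shat : ℝ → State d S → State d S → ℝ≥0)
    (p0 : PMF (State d S)) : ℕ → PMF (State d S)
  | 0 => p0
  | k + 1 => (algLaw g shat p0 k).bind (stepLaw g shat k)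

/-- The law of the output `x_{t_N}` of the algorithm started from `p0`. -/
def outputLaw {d S : ℕ} [NeZero S] (g : TimeGrid) (shat : ℝ → State d S → State d S → ℝ≥0)
    (p0 : PMF (State d S)) : PMF (State d S) :=
  algLaw g shat p0 g.N

/-! ### Information quantities -/

/-- The Kullback-Leibler divergence of two laws on a discrete space. -/
def pmfKL {α : Type*} (p q : PMF α) : ℝ≥0∞ :=
  letI : MeasurableSpace α := ⊤
  InformationTheory.klDiv p.toMeasure q.toMeasure

/-- The probability of the event `E` under the p.m.f. `p`. -/
def prob {Ω : Type*} [Fintype Ω] (p : Ω → ℝ) (E : Ω → Prop) [DecidablePred E] : ℝ :=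
  ∑ ω, if E ω then p ω else 0

/-- The conditional mutual information `I(A; B | C)` of random variables on a finite space with
p.m.f. `p`: the expectation of the logarithm of
`P(A, B, C) P(C) / (P(A, C) P(B, C))` evaluated at the outcome. -/
def condMutualInfo {Ω α β γ : Type*} [Fintype Ω] [DecidableEq α] [DecidableEq β] [DecidableEq γ]
    (p : Ω → ℝ) (A : Ω → α) (B : Ω → β) (C : Ω → γ) : ℝ :=
  ∑ ω, p ω * Real.log
    (prob p (fun η => A η = A ω ∧ B η = B ω ∧ C η = C ω) * prob p (fun η => C η = C ω) /
      (prob p (fun η => A η = A ω ∧ C η = C ω) * prob p (fun η => B η = B ω ∧ C η = C ω)))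

/-- `I(t) = ∑_{i ≠ j} I(x_t^i; x_t^j | x_t^{-(i, j)})` for `x_t ∼ q_t`, where `x^{-(i, j)}` is the
vector of all the coordinates of `x` other than `i` and `j` (equivalently, the collection of its
unmasked ones). -/
def pairInfo {d S : ℕ} (qdata : PMF (Fin d → Fin S)) (t : ℝ) : ℝ :=
  ∑ i, ∑ j ∈ Finset.univ.erase i,
    condMutualInfo (marginal qdata t) (fun x : State d S => x i) (fun x => x j)
      (fun x (l : {l : Fin d // l ≠ i ∧ l ≠ j}) => x l)

end MaskingDiffusion

end

open scoped ENNReal NNReal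

noncomputable section

namespace MaskingDiffusion

variable {d S : ℕ}

/-! ### The rate matrix as an operator -/

/-! Write m(x) (`partialMass`) for the data mass compatible with the unmasked tokens of x. Masking
ignores token values, so q_t(x) = w(x) m(x), where w is the probability of the mask pattern when
each token survives with probability e^{-t} (`marginal_eq`). Run backwards from t to t' < t, the
process keeps each mask independently with probability ρ = (1 - e^{-t'}) / (1 - e^{-t}) and draws
the revealed tokens from the data conditioned on x. The sampler's kernel is a product over
coordinates, so it errs in two ways: its one-coordinate laws are estimates, and it ignores the
dependence between tokens revealed together. The chain rule (`relEnt_step_le`) adds up these errors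
over the steps.

Dependence. Let M(t) = E log m(x_t). Comparing the exact kernel with the product of its
one-coordinate laws costs M(t') - M(t) + (e^{t-t'} - 1) M'(t) (`relEnt_marginal_step_le`). Mask
weights cancel in the conditional mutual information, which is therefore a mixed second difference
of log m, and summing over pairs gives I = M'' + M' (`pairInfo_eq`). Since (e^{s-t'} - 1) M'(s) -
M(s) has derivative (e^{s-t'} - 1) I(s), the cost equals the integral of (e^{s-t'} - 1) I(s), at
most (e^h - 1) times that of I.

Estimation. A masked coordinate is an exponential clock followed by the draw of a token. The score
entropy splits in the same way (`sum_weightedBregman`), and convexity of log ((1 - e^{-x}) / x)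
controls the clock part (`exp_clock_kl_le`). The resulting factor (1 - ρ) / s, with s the true total
unmasking rate, is again e^h - 1.

The initial error is at most e^{-T} d log S (`relEnt_initLaw_le`), and e^h - 1 ≤ e^{|Δ₀|} h gives
the constant. -/

theorem offDiagRate_eq (x y : State d S) :
    offDiagRate x y = ∑ i, if x i ≠ none ∧ y = setCoord x i none then 1 else 0 := by
  unfold offDiagRate
  split_ifs with h
  · rw [hammingDist, Finset.card_eq_one] at h
    obtain ⟨i, hi⟩ := h
    have hne : x i ≠ y i := by
      have : i ∈ ({i} : Finset (Fin d)) := Finset.mem_singleton_self i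
      rw [← hi] at this
      simpa using this
    have heq : ∀ j, j ≠ i → x j = y j := fun j hj => by
      by_contra hc
      have : j ∈ ({i} : Finset (Fin d)) := by rw [← hi]; simpa using hc
      exact hj (by simpa using this)
    rw [Finset.sum_eq_single i, Finset.sum_eq_single i]
    · unfold tokRate
      refine if_congr (and_congr_right fun _ => ?_) rfl rfl
      constructor
      · intro hy
        funext j
        by_cases hj : j = i
        · subst hj; simp [setCoord, hy]
        · simp [setCoord, hj, heq j hj]
      · intro hy
        rw [hy]; simp [setCoord]
    · intro j _ hj
      rw [if_neg]
      rintro ⟨h1, h2⟩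
      have := heq j hj
      rw [h2] at this
      exact h1 (by simpa [setCoord] using this)
    · simp
    · intro j _ hj
      rw [heq j hj]
      simp [tokRate]
    · simp
  · symm
    refine Finset.sum_eq_zero fun i _ => if_neg ?_
    rintro ⟨h1, rfl⟩
    apply h
    rw [hammingDist, Finset.card_eq_one]
    refine ⟨i, ?_⟩
    ext j
    by_cases hj : j = i
    · subst hj
      simp only [Finset.mem_filter, Finset.mem_univ, true_and, Finset.mem_singleton, iff_true]
      simpa [setCoord] using h1
    · simp only [Finset.mem_filter, Finset.mem_univ, true_and, Finset.mem_singleton, hj, iff_false,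
        not_not]
      simp [setCoord, hj]

/-- Masking an already masked coordinate changes nothing, so the sum needs no restriction to
unmasked ones. -/
theorem rateMatrix_mulVec (F : State d S → ℝ) (x : State d S) :
    ∑ y, rateMatrix d S x y * F y = ∑ i, (F (setCoord x i none) - F x) := by
  have hxx : offDiagRate x x = 0 := by simp [offDiagRate]
  have h1 : ∑ y, rateMatrix d S x y * F y = ∑ y, offDiagRate x y * (F y - F x) := by
    rw [← Finset.add_sum_erase _ _ (Finset.mem_univ x),
      ← Finset.add_sum_erase Finset.univ (fun y => offDiagRate x y * (F y - F x))
        (Finset.mem_univ x)]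
    simp only [rateMatrix, if_true, hxx, zero_mul, zero_add, neg_mul, Finset.sum_mul]
    rw [neg_add_eq_sub, ← Finset.sum_sub_distrib]
    refine Finset.sum_congr rfl fun y hy => ?_
    rw [if_neg (Finset.ne_of_mem_erase hy).symm]
    ring
  rw [h1]
  simp only [offDiagRate_eq, Finset.sum_mul]
  rw [Finset.sum_comm]
  refine Finset.sum_congr rfl fun i _ => ?_
  by_cases hi : x i = none
  · have : setCoord x i none = x := by rw [← hi]; simp [setCoord]
    simp [hi, this]
  · simp [hi]

/-! ### Closed form of the marginals -/

/-- Indicator of compatibility of a possibly masked token with a token. -/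
def tokCompat (b : Fin S) (c : Token S) : ℝ := if c = none ∨ c = some b then 1 else 0

theorem tokCompat_nonneg (b : Fin S) (c : Token S) : 0 ≤ tokCompat b c := by
  unfold tokCompat; split_ifs <;> norm_num

theorem tokCompat_le_one (b : Fin S) (c : Token S) : tokCompat b c ≤ 1 := by
  unfold tokCompat; split_ifs <;> norm_num

@[simp] theorem tokCompat_none (b : Fin S) : tokCompat b none = 1 := by simp [tokCompat]

theorem tokCompat_some (b c : Fin S) : tokCompat b (some c) = if c = b then 1 else 0 := by
  simp [tokCompat]

/-- The probability that the data agrees with the unmasked coordinates of `y`. -/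
def partialMass (qdata : PMF (Fin d → Fin S)) (y : State d S) : ℝ :=
  ∑ z, (qdata z).toReal * ∏ i, tokCompat (z i) (y i)

/-- The probability of the mask pattern of a token, when tokens stay unmasked with
probability `a`. -/
def tokWeight (a : ℝ) (c : Token S) : ℝ := if c = none then 1 - a else a

/-- The probability of the mask pattern of `y`, when tokens stay unmasked with
probability `a`. -/
def weight (a : ℝ) (y : State d S) : ℝ := ∏ i, tokWeight a (y i)

theorem tokWeight_nonneg {a : ℝ} (h0 : 0 ≤ a) (h1 : a ≤ 1) (c : Token S) : 0 ≤ tokWeight a c := by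
  unfold tokWeight; split_ifs <;> linarith

theorem weight_nonneg {a : ℝ} (h0 : 0 ≤ a) (h1 : a ≤ 1) (y : State d S) : 0 ≤ weight a y :=
  Finset.prod_nonneg fun _ _ => tokWeight_nonneg h0 h1 _

theorem weight_pos {a : ℝ} (h0 : 0 < a) (h1 : a < 1) (y : State d S) : 0 < weight a y :=
  Finset.prod_pos fun _ _ => by unfold tokWeight; split_ifs <;> linarith

theorem partialMass_nonneg (qdata : PMF (Fin d → Fin S)) (y : State d S) :
    0 ≤ partialMass qdata y :=
  Finset.sum_nonneg fun _ _ => mul_nonneg ENNReal.toReal_nonneg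
    (Finset.prod_nonneg fun _ _ => tokCompat_nonneg _ _)

theorem sum_toReal_pmf {α : Type*} [Fintype α] (p : PMF α) : ∑ z, (p z).toReal = 1 := by
  rw [← ENNReal.toReal_sum fun a _ => p.apply_ne_top a, ← tsum_fintype (L := .unconditional _),
    p.tsum_coe, ENNReal.toReal_one]

theorem partialMass_le_one (qdata : PMF (Fin d → Fin S)) (y : State d S) :
    partialMass qdata y ≤ 1 := by
  rw [← sum_toReal_pmf qdata]
  refine Finset.sum_le_sum fun z _ => mul_le_of_le_one_right ENNReal.toReal_nonneg ?_
  exact Finset.prod_le_one (fun _ _ => tokCompat_nonneg _ _) fun _ _ => tokCompat_le_one _ _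

/-! ### Replacing one coordinate, and sums of partial masses. -/

theorem prod_setCoord (f : Fin d → Token S → ℝ) (x : State d S) (i : Fin d) (c : Token S) :
    ∏ j, f j (setCoord x i c j) = f i c * ∏ j ∈ Finset.univ.erase i, f j (x j) := by
  rw [← Finset.mul_prod_erase _ _ (Finset.mem_univ i)]
  congr 1
  · simp [setCoord]
  · refine Finset.prod_congr rfl fun j hj => ?_
    simp [setCoord, Finset.ne_of_mem_erase hj]

@[simp] theorem setCoord_setCoord (x : State d S) (i : Fin d) (c c' : Token S) :
    setCoord (setCoord x i c) i c' = setCoord x i c' := by simp [setCoord]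

@[simp] theorem setCoord_self (x : State d S) (i : Fin d) : setCoord x i (x i) = x := by
  simp [setCoord]

@[simp] theorem setCoord_apply_self (x : State d S) (i : Fin d) (c : Token S) :
    setCoord x i c i = c := by simp [setCoord]

theorem setCoord_apply_ne (x : State d S) {i j : Fin d} (h : j ≠ i) (c : Token S) :
    setCoord x i c j = x j := by simp [setCoord, h]

theorem setCoord_eq_self {x : State d S} {i : Fin d} {c : Token S} (h : x i = c) :
    setCoord x i c = x := by rw [← h, setCoord_self]

/-- A state compatible with a data point `z` has, at each coordinate, the mask or `z j`; exchanging
the sums makes the inner one factorize. Mask weights, reveal kernels and one-coordinate test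
functions are all instances of `r`. -/
theorem sum_partialMass_mul_prod (qdata : PMF (Fin d → Fin S)) (r : Fin d → Token S → ℝ) :
    ∑ y, partialMass qdata y * ∏ j, r j (y j) =
      ∑ z, (qdata z).toReal * ∏ j, (r j none + r j (some (z j))) := by
  simp only [partialMass, Finset.sum_mul]
  rw [Finset.sum_comm]
  refine Finset.sum_congr rfl fun z _ => ?_
  simp only [mul_assoc, ← Finset.mul_sum, ← Finset.prod_mul_distrib]
  congr 1
  rw [← Fintype.prod_sum (fun j c => tokCompat (z j) c * r j c)]
  refine Finset.prod_congr rfl fun j _ => ?_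
  rw [Fintype.sum_option]
  simp [tokCompat_some]

theorem sum_partialMass_setCoord_some (qdata : PMF (Fin d → Fin S)) (x : State d S) (i : Fin d) :
    ∑ b, partialMass qdata (setCoord x i (some b)) = partialMass qdata (setCoord x i none) := by
  simp only [partialMass]
  rw [Finset.sum_comm]
  refine Finset.sum_congr rfl fun z _ => ?_
  rw [← Finset.mul_sum]
  simp only [prod_setCoord (fun j c => tokCompat (z j) c), tokCompat_some, tokCompat_none,
    ← Finset.sum_mul]
  simp

theorem partialMass_setCoord_none_ge (qdata : PMF (Fin d → Fin S)) (x : State d S) (i : Fin d) :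
    partialMass qdata x ≤ partialMass qdata (setCoord x i none) := by
  refine Finset.sum_le_sum fun z _ => mul_le_mul_of_nonneg_left ?_ ENNReal.toReal_nonneg
  refine Finset.prod_le_prod (fun _ _ => tokCompat_nonneg _ _) fun j _ => ?_
  by_cases hj : j = i
  · subst hj; simpa using tokCompat_le_one _ _
  · rw [setCoord_apply_ne x hj]

theorem weight_setCoord (a : ℝ) (x : State d S) (i : Fin d) (c : Token S) :
    weight a (setCoord x i c) = tokWeight a c * ∏ j ∈ Finset.univ.erase i, tokWeight a (x j) :=
  prod_setCoord (fun _ c => tokWeight a c) x i c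

theorem weight_eq_mul_erase (a : ℝ) (x : State d S) (i : Fin d) :
    weight a x = tokWeight a (x i) * ∏ j ∈ Finset.univ.erase i, tokWeight a (x j) :=
  (Finset.mul_prod_erase _ _ (Finset.mem_univ i)).symm

/-- The token masses add up to the mass with `i` masked, so the factors 1 - a and a combine to one.
-/
theorem sum_weight_mul_partialMass_setCoord (qdata : PMF (Fin d → Fin S)) (a : ℝ) (x : State d S)
    (i : Fin d) :
    ∑ c, weight a (setCoord x i c) * partialMass qdata (setCoord x i c) =
      (∏ j ∈ Finset.univ.erase i, tokWeight a (x j)) * partialMass qdata (setCoord x i none) := by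
  rw [Fintype.sum_option]
  simp only [weight_setCoord, tokWeight, if_true, reduceCtorEq, if_false]
  rw [← Finset.mul_sum, sum_partialMass_setCoord_some]
  ring

/-- Splitting a sum over states along the coordinate `i`. -/
theorem sum_eq_sum_setCoord {M : Type*} [AddCommMonoid M] (F : State d S → M) (i : Fin d) :
    ∑ y, F y = ∑ x, if x i = none then ∑ c, F (setCoord x i c) else 0 := by
  rw [← Finset.sum_filter, ← Finset.sum_product']
  refine Finset.sum_bij' (fun y _ => (setCoord y i none, y i)) (fun p _ => setCoord p.1 i p.2)
    ?_ ?_ ?_ ?_ ?_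
  · intro y _; simp
  · intro p _; simp
  · intro y _; simp
  · rintro ⟨x, c⟩ h
    simp only [Finset.mem_product, Finset.mem_filter, Finset.mem_univ, true_and, and_true] at h
    simp [setCoord_eq_self h]
  · intro y _; simp

theorem sum_ite_setCoord_none (c : State d S → ℝ) (x : State d S) (i : Fin d) :
    (∑ y, c y * if setCoord y i none = x then 1 else 0) =
      if x i = none then ∑ b, c (setCoord x i b) else 0 := by
  rw [sum_eq_sum_setCoord _ i]
  simp only [setCoord_setCoord]
  rw [Finset.sum_eq_single x]
  · by_cases h : x i = none
    · simp only [h, if_true, setCoord_eq_self h, mul_one]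
    · simp only [h, if_false]
  · intro y _ hy
    by_cases h : y i = none
    · simp only [h, if_true, setCoord_eq_self h, hy, if_false, mul_zero, Finset.sum_const_zero]
    · simp only [h, if_false]
  · simp

/-! ### The forward equation. -/

theorem hasDerivAt_tokWeight (t : ℝ) (c : Token S) :
    HasDerivAt (fun t => tokWeight (Real.exp (-t)) c)
      (if c = none then Real.exp (-t) else -Real.exp (-t)) t := by
  have h : HasDerivAt (fun t => Real.exp (-t)) (-Real.exp (-t)) t := by
    simpa using (hasDerivAt_neg t).exp
  unfold tokWeight
  split_ifs with hc
  · simpa using h.const_sub 1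
  · exact h

/-- Mass enters `x` through its masked coordinates. There `b` also runs over the mask, and that term
cancels `- c x`, so only unmasked coordinates lose mass. -/
theorem sum_rateMatrix_column (c : State d S → ℝ) (x : State d S) :
    ∑ y, c y * rateMatrix d S y x =
      ∑ i, ((if x i = none then ∑ b, c (setCoord x i b) else 0) - c x) := by
  have h : ∀ y, rateMatrix d S y x =
      ∑ i, ((if setCoord y i none = x then (1 : ℝ) else 0) - if y = x then 1 else 0) := fun y => by
    rw [← rateMatrix_mulVec (fun z => if z = x then (1 : ℝ) else 0) y]
    simp
  simp only [h, Finset.mul_sum, mul_sub]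
  rw [Finset.sum_comm]
  simp only [Finset.sum_sub_distrib, sum_ite_setCoord_none]
  simp

/-- The product rule gives one term per coordinate, and it equals the net flow through that
coordinate. -/
theorem hasDerivAt_weight_mul_partialMass (qdata : PMF (Fin d → Fin S)) (t : ℝ) (x : State d S) :
    HasDerivAt (fun t => weight (Real.exp (-t)) x * partialMass qdata x)
      (∑ y, (weight (Real.exp (-t)) y * partialMass qdata y) * rateMatrix d S y x) t := by
  have h := (HasDerivAt.fun_finsetProd (u := Finset.univ)
    (f := fun i t => tokWeight (Real.exp (-t)) (x i)) (x := t)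
    fun i _ => hasDerivAt_tokWeight t (x i)).mul_const (partialMass qdata x)
  refine h.congr_deriv ?_
  rw [sum_rateMatrix_column, Finset.sum_mul]
  refine Finset.sum_congr rfl fun i _ => ?_
  rw [sum_weight_mul_partialMass_setCoord, weight_eq_mul_erase _ x i]
  split_ifs with hi
  · rw [setCoord_eq_self hi]
    simp only [tokWeight, hi, if_true, smul_eq_mul]; ring
  · simp only [tokWeight, hi, if_false, smul_eq_mul]; ring

section
attribute [local instance] Matrix.linftyOpNormedRing Matrix.linftyOpNormedAlgebra

/-- Differentiation needs a norm on matrices; the operator norm is local to this section, and the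
entrywise conclusion does not mention it. -/
theorem hasDerivAt_exp_smul_apply' {n : Type*} [Fintype n] [DecidableEq n] (A : Matrix n n ℝ)
    (t : ℝ) (x y : n) :
    HasDerivAt (fun t : ℝ => NormedSpace.exp (t • A) x y)
      (∑ z, A x z * NormedSpace.exp (t • A) z y) t := by
  have h := hasDerivAt_exp_smul_const' A t
  have h2 := hasDerivAt_pi.1 (hasDerivAt_pi.1 h x) y
  exact h2.congr_deriv (Matrix.mul_apply ..)

/-- A solution of `c' = c A` is `c 0 * exp (t A)`. -/
theorem eq_vecMul_exp_of_hasDerivAt {n : Type*} [Fintype n] [DecidableEq n] (A : Matrix n n ℝ)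
    (c : ℝ → n → ℝ) (hc : ∀ t x, HasDerivAt (fun t => c t x) (∑ y, c t y * A y x) t) (t : ℝ) :
    c t = Matrix.vecMul (c 0) (NormedSpace.exp (t • A)) := by
  -- The product rule gives c A exp(-tA) - c A exp(-tA) once summation indices are exchanged.
  have hd : ∀ x t, HasDerivAt (fun t : ℝ => Matrix.vecMul (c t) (NormedSpace.exp (t • -A)) x) 0 t := by
    intro x t
    have := HasDerivAt.fun_sum (u := Finset.univ) (x := t) fun y _ =>
      (hc t y).mul (hasDerivAt_exp_smul_apply' (-A) t y x)
    refine this.congr_deriv ?_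
    simp only [Finset.sum_add_distrib, Finset.mul_sum, Finset.sum_mul]
    rw [Finset.sum_comm, ← Finset.sum_add_distrib]
    refine Finset.sum_eq_zero fun y _ => ?_
    rw [← Finset.sum_add_distrib]
    refine Finset.sum_eq_zero fun z _ => ?_
    simp only [Matrix.neg_apply]; ring
  have hconst : Matrix.vecMul (c t) (NormedSpace.exp (t • -A)) = c 0 := by
    funext x
    have := is_const_of_deriv_eq_zero (fun t => (hd x t).differentiableAt)
      (fun t => (hd x t).deriv) t 0
    simpa using this
  rw [← hconst, Matrix.vecMul_vecMul, ← Matrix.exp_add_of_commute]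
  · simp
  · simp only [smul_neg]
    exact (Commute.refl _).neg_left

end

theorem weight_one (x : State d S) : weight 1 x = if ∀ i, x i ≠ none then 1 else 0 := by
  unfold weight tokWeight
  split_ifs with h
  · exact Finset.prod_eq_one fun i _ => by simp [h i]
  · push Not at h
    obtain ⟨i, hi⟩ := h
    exact Finset.prod_eq_zero (Finset.mem_univ i) (by simp [hi])

theorem embedData_toReal (qdata : PMF (Fin d → Fin S)) (x : State d S) :
    (embedData qdata x).toReal = weight 1 x * partialMass qdata x := by
  classical
  rw [embedData, PMF.map_apply, tsum_fintype, ENNReal.toReal_sum, weight_one]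
  · unfold partialMass
    rw [Finset.mul_sum]
    refine Finset.sum_congr rfl fun z _ => ?_
    rw [apply_ite ENNReal.toReal, ENNReal.toReal_zero]
    split_ifs with h1 h2 h2
    · subst h1; simp [tokCompat]
    · exact absurd (fun i => by rw [h1]; simp) h2
    · have : ∃ i, x i ≠ some (z i) := by
        by_contra hc; push Not at hc; exact h1 (funext hc)
      obtain ⟨i, hi⟩ := this
      rw [Finset.prod_eq_zero (Finset.mem_univ i)]
      · simp
      · simp [tokCompat, h2 i, hi]
    · simp
  · intro z _
    split_ifs
    · exact qdata.apply_ne_top z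
    · simp

/-- Uniqueness for a linear equation: the product formula solves the forward equation and equals the
data law at time zero. -/
theorem marginal_eq (qdata : PMF (Fin d → Fin S)) (t : ℝ) (x : State d S) :
    marginal qdata t x = weight (Real.exp (-t)) x * partialMass qdata x := by
  have h := eq_vecMul_exp_of_hasDerivAt (rateMatrix d S)
    (fun t x => weight (Real.exp (-t)) x * partialMass qdata x)
    (fun t x => hasDerivAt_weight_mul_partialMass qdata t x) t
  rw [marginal]
  refine Eq.trans ?_ (congrFun h x).symm
  congr 2
  funext y
  rw [embedData_toReal]; simp

theorem marginal_zero (qdata : PMF (Fin d → Fin S)) (x : State d S) :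
    marginal qdata 0 x = (embedData qdata x).toReal := by
  rw [marginal_eq, embedData_toReal]; simp

theorem marginal_nonneg (qdata : PMF (Fin d → Fin S)) {t : ℝ} (ht : 0 ≤ t) (x : State d S) :
    0 ≤ marginal qdata t x := by
  rw [marginal_eq]
  exact mul_nonneg (weight_nonneg (Real.exp_pos _).le (Real.exp_le_one_iff.2 (by linarith)) _)
    (partialMass_nonneg _ _)

/-- The expectation of `F` under the marginal at time `t`. -/
def marginalMean (qdata : PMF (Fin d → Fin S)) (F : State d S → ℝ) (t : ℝ) : ℝ :=
  ∑ x, marginal qdata t x * F x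

/-- The generator of the masking process. -/
def generator (F : State d S → ℝ) (x : State d S) : ℝ := ∑ i, (F (setCoord x i none) - F x)

theorem hasDerivAt_marginalMean (qdata : PMF (Fin d → Fin S)) (F : State d S → ℝ) (t : ℝ) :
    HasDerivAt (marginalMean qdata F) (marginalMean qdata (generator F) t) t := by
  have h : HasDerivAt (fun t => ∑ x, (weight (Real.exp (-t)) x * partialMass qdata x) * F x)
      _ t := HasDerivAt.fun_sum fun x _ =>
    (hasDerivAt_weight_mul_partialMass qdata t x).mul_const (F x)
  have e : marginalMean qdata F =
      fun t => ∑ x, (weight (Real.exp (-t)) x * partialMass qdata x) * F x := by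
    funext t; simp [marginalMean, marginal_eq]
  rw [e]
  refine h.congr_deriv ?_
  simp only [marginalMean, generator, ← rateMatrix_mulVec, marginal_eq, Finset.sum_mul,
    Finset.mul_sum]
  rw [Finset.sum_comm]
  simp only [mul_assoc]

/-! ### Conditional mutual information -/

theorem prob_pos_of_mem {Ω : Type*} [Fintype Ω] {p : Ω → ℝ} (hp : ∀ ω, 0 ≤ p ω)
    (E : Ω → Prop) [DecidablePred E] {ω : Ω} (hω : 0 < p ω) (h : E ω) : 0 < prob p E := by
  refine Finset.sum_pos' (fun η _ => ?_) ⟨ω, Finset.mem_univ _, by simpa [h] using hω⟩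
  split_ifs
  exacts [hp η, le_rfl]

theorem prob_nonneg {Ω : Type*} [Fintype Ω] {p : Ω → ℝ} (hp : ∀ ω, 0 ≤ p ω)
    (E : Ω → Prop) [DecidablePred E] : 0 ≤ prob p E := by
  refine Finset.sum_nonneg fun η _ => ?_
  split_ifs
  exacts [hp η, le_rfl]

/-- The inverse likelihood ratio has mean at most one. Its numerator is expanded with independent
copies `η`, `θ`; summing over `ω` first cancels P(A, B, C) and forces C to agree on the copies.
Equality can fail because values of (A, B, C) of probability zero are missed by the sum over `ω`. -/
theorem sum_mul_prob_div_le {Ω α β γ : Type*} [Fintype Ω] [DecidableEq α] [DecidableEq β]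
    [DecidableEq γ] {p : Ω → ℝ} (hp : ∀ ω, 0 ≤ p ω) (A : Ω → α) (B : Ω → β) (C : Ω → γ) :
    ∑ ω, p ω * (prob p (fun η => A η = A ω ∧ C η = C ω) * prob p (fun η => B η = B ω ∧ C η = C ω) /
      (prob p (fun η => A η = A ω ∧ B η = B ω ∧ C η = C ω) * prob p (fun η => C η = C ω)))
      ≤ ∑ ω, p ω := by
  set PC : Ω → ℝ := fun ω => prob p (fun η => C η = C ω) with hPC
  set PABC : Ω → ℝ := fun ω => prob p (fun η => A η = A ω ∧ B η = B ω ∧ C η = C ω) with hPABC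
  have hC0 : ∀ ω, 0 ≤ PC ω := fun ω => prob_nonneg hp _
  have h1 : ∀ ω, p ω * (prob p (fun η => A η = A ω ∧ C η = C ω) *
      prob p (fun η => B η = B ω ∧ C η = C ω) / (PABC ω * PC ω)) =
      ∑ η, ∑ θ, p η * p θ * if (A η = A ω ∧ C η = C ω) ∧ (B θ = B ω ∧ C θ = C ω) then
        p ω / (PABC ω * PC ω) else 0 := fun ω => by
    have : prob p (fun η => A η = A ω ∧ C η = C ω) * prob p (fun η => B η = B ω ∧ C η = C ω) =
      ∑ η, ∑ θ, p η * p θ * if (A η = A ω ∧ C η = C ω) ∧ (B θ = B ω ∧ C θ = C ω) then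
        1 else 0 := by
      unfold prob
      rw [Finset.sum_mul_sum]
      refine Finset.sum_congr rfl fun η _ => Finset.sum_congr rfl fun θ _ => ?_
      by_cases hE : A η = A ω ∧ C η = C ω <;> by_cases hF : B θ = B ω ∧ C θ = C ω <;>
        simp only [hE, hF, and_true, true_and, and_self, if_true, if_false, mul_one, mul_zero,
          zero_mul]
    rw [this, mul_div_assoc', mul_comm, mul_div_assoc, Finset.sum_mul]
    refine Finset.sum_congr rfl fun η _ => ?_
    rw [Finset.sum_mul]
    refine Finset.sum_congr rfl fun θ _ => ?_
    split_ifs <;> simp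
  have h2 : ∀ η θ, (∑ ω, if (A η = A ω ∧ C η = C ω) ∧ (B θ = B ω ∧ C θ = C ω) then
      p ω / (PABC ω * PC ω) else 0) ≤ if C θ = C η then 1 / PC η else 0 := fun η θ => by
    split_ifs with hc
    · have e : ∀ ω, (if (A η = A ω ∧ C η = C ω) ∧ (B θ = B ω ∧ C θ = C ω) then
          p ω / (PABC ω * PC ω) else 0) = (if A ω = A η ∧ B ω = B θ ∧ C ω = C η then p ω else 0) /
          (prob p (fun ω => A ω = A η ∧ B ω = B θ ∧ C ω = C η) * PC η) := fun ω => by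
        by_cases h : A ω = A η ∧ B ω = B θ ∧ C ω = C η
        · obtain ⟨ha, hb, hc'⟩ := h
          have e1 : PABC ω = prob p (fun ω => A ω = A η ∧ B ω = B θ ∧ C ω = C η) := by
            simp only [hPABC, ha, hb, hc']
          have e2 : PC ω = PC η := by simp only [hPC, hc']
          rw [if_pos ⟨⟨ha.symm, hc'.symm⟩, hb.symm, hc.trans hc'.symm⟩, if_pos ⟨ha, hb, hc'⟩,
            e1, e2]
        · rw [if_neg h, if_neg, zero_div]
          rintro ⟨⟨ha, hc'⟩, hb, -⟩
          exact h ⟨ha.symm, hb.symm, hc'.symm⟩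
      rw [Finset.sum_congr rfl fun ω _ => e ω, ← Finset.sum_div]
      change prob p _ / _ ≤ _
      rw [← div_div]
      exact div_le_div_of_nonneg_right (div_self_le_one _) (hC0 η)
    · refine (Finset.sum_eq_zero fun ω _ => if_neg ?_).le
      rintro ⟨⟨-, h⟩, -, h'⟩
      exact hc (h'.trans h.symm)
  calc _ = ∑ ω, ∑ η, ∑ θ, p η * p θ * if (A η = A ω ∧ C η = C ω) ∧ (B θ = B ω ∧ C θ = C ω) then
        p ω / (PABC ω * PC ω) else 0 := Finset.sum_congr rfl fun ω _ => h1 ω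
    _ = ∑ η, ∑ θ, p η * p θ * ∑ ω, if (A η = A ω ∧ C η = C ω) ∧ (B θ = B ω ∧ C θ = C ω) then
        p ω / (PABC ω * PC ω) else 0 := by
      rw [Finset.sum_comm]
      refine Finset.sum_congr rfl fun η _ => ?_
      rw [Finset.sum_comm]
      simp only [Finset.mul_sum]
    _ ≤ ∑ η, ∑ θ, p η * p θ * if C θ = C η then 1 / PC η else 0 :=
      Finset.sum_le_sum fun η _ => Finset.sum_le_sum fun θ _ =>
        mul_le_mul_of_nonneg_left (h2 η θ) (mul_nonneg (hp η) (hp θ))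
    _ ≤ ∑ η, p η := by
      refine Finset.sum_le_sum fun η _ => ?_
      have : ∑ θ, p η * p θ * (if C θ = C η then 1 / PC η else 0) = p η * (PC η / PC η) := by
        rw [hPC]
        unfold prob
        rw [Finset.sum_div, Finset.mul_sum]
        refine Finset.sum_congr rfl fun θ _ => ?_
        split_ifs <;> ring
      rw [this]
      exact mul_le_of_le_one_right (hp η) (div_self_le_one _)

/-- Apply log u ≥ 1 - 1/u to the likelihood ratio; `sum_mul_prob_div_le` bounds the mean of 1/u. -/
theorem condMutualInfo_nonneg {Ω α β γ : Type*} [Fintype Ω] [DecidableEq α] [DecidableEq β]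
    [DecidableEq γ] {p : Ω → ℝ} (hp : ∀ ω, 0 ≤ p ω) (A : Ω → α) (B : Ω → β) (C : Ω → γ) :
    0 ≤ condMutualInfo p A B C := by
  have h := sum_mul_prob_div_le hp A B C
  rw [← sub_nonneg, ← Finset.sum_sub_distrib] at h
  refine h.trans (Finset.sum_le_sum fun ω _ => ?_)
  rcases (hp ω).eq_or_lt with h0 | h0
  · simp [← h0]
  · have := Real.one_sub_inv_le_log_of_pos (div_pos
      (mul_pos (prob_pos_of_mem hp (fun η => A η = A ω ∧ B η = B ω ∧ C η = C ω) h0 ⟨rfl, rfl, rfl⟩)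
        (prob_pos_of_mem hp (fun η => C η = C ω) h0 rfl))
      (mul_pos (prob_pos_of_mem hp (fun η => A η = A ω ∧ C η = C ω) h0 ⟨rfl, rfl⟩)
        (prob_pos_of_mem hp (fun η => B η = B ω ∧ C η = C ω) h0 ⟨rfl, rfl⟩)))
    rw [inv_div] at this
    have := mul_le_mul_of_nonneg_left this h0.le
    linarith

theorem pairInfo_nonneg (qdata : PMF (Fin d → Fin S)) {t : ℝ} (ht : 0 ≤ t) :
    0 ≤ pairInfo qdata t :=
  Finset.sum_nonneg fun _ _ => Finset.sum_nonneg fun _ _ =>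
    condMutualInfo_nonneg (marginal_nonneg qdata ht) _ _ _

/-! ### The pairwise information as a second derivative -/

theorem sum_tokWeight_mul_partialMass (qdata : PMF (Fin d → Fin S)) (a : ℝ) (x : State d S)
    (i : Fin d) :
    ∑ c, tokWeight a c * partialMass qdata (setCoord x i c) =
      partialMass qdata (setCoord x i none) := by
  rw [Fintype.sum_option]
  simp only [tokWeight, if_true, reduceCtorEq, if_false]
  rw [← Finset.mul_sum, sum_partialMass_setCoord_some]
  ring

theorem setCoord_none_eq_iff (η ω : State d S) (i : Fin d) :
    setCoord η i none = setCoord ω i none ↔ ∀ l, l ≠ i → η l = ω l := by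
  constructor
  · intro h l hl
    have := congrFun h l
    rwa [setCoord_apply_ne _ hl, setCoord_apply_ne _ hl] at this
  · intro h
    funext l
    by_cases hl : l = i
    · subst hl; simp
    · rw [setCoord_apply_ne _ hl, setCoord_apply_ne _ hl, h l hl]

theorem prob_congr {Ω : Type*} [Fintype Ω] (p : Ω → ℝ) {E F : Ω → Prop} [DecidablePred E]
    [DecidablePred F] (h : ∀ ω, E ω ↔ F ω) : prob p E = prob p F :=
  Finset.sum_congr rfl fun ω _ => if_congr (h ω) rfl rfl

theorem prob_marginal_setCoord (qdata : PMF (Fin d → Fin S)) (t : ℝ) (ω : State d S) (i : Fin d) :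
    prob (marginal qdata t) (fun η => setCoord η i none = setCoord ω i none) =
      (∏ l ∈ Finset.univ.erase i, tokWeight (Real.exp (-t)) (ω l)) *
        partialMass qdata (setCoord ω i none) := by
  have h : prob (marginal qdata t) (fun η => setCoord η i none = setCoord ω i none) =
      ∑ y, marginal qdata t y * if setCoord y i none = setCoord ω i none then 1 else 0 := by
    simp [prob]
  rw [h, sum_ite_setCoord_none, if_pos (setCoord_apply_self ..)]
  simp only [setCoord_setCoord, marginal_eq]
  exact sum_weight_mul_partialMass_setCoord ..

/-- The coordinates are summed out one after the other: `i` leaves a function carried by states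
masked at `i`, on which the summation over `j` acts. -/
theorem prob_marginal_setCoord_setCoord (qdata : PMF (Fin d → Fin S)) (t : ℝ) (ω : State d S)
    {i j : Fin d} (hij : i ≠ j) :
    prob (marginal qdata t) (fun η =>
        setCoord (setCoord η i none) j none = setCoord (setCoord ω i none) j none) =
      (∏ l ∈ (Finset.univ.erase i).erase j, tokWeight (Real.exp (-t)) (ω l)) *
        partialMass qdata (setCoord (setCoord ω i none) j none) := by
  set x := setCoord (setCoord ω i none) j none with hx
  have hxi : x i = none := by rw [hx, setCoord_apply_ne _ hij]; simp
  have hxj : x j = none := by simp [hx]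
  have hxl : ∀ l, l ≠ i → l ≠ j → x l = ω l := fun l h1 h2 => by
    rw [hx, setCoord_apply_ne _ h2, setCoord_apply_ne _ h1]
  have h : prob (marginal qdata t) (fun η => setCoord (setCoord η i none) j none = x) =
      ∑ y, marginal qdata t y * if setCoord (setCoord y i none) j none = x then 1 else 0 := by
    simp [prob]
  have h2 : ∑ y, marginal qdata t y * (if setCoord (setCoord y i none) j none = x then 1 else 0) =
      ∑ y, (if y i = none then (∏ l ∈ Finset.univ.erase i, tokWeight (Real.exp (-t)) (y l)) *
        partialMass qdata y else 0) * if setCoord y j none = x then 1 else 0 := by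
    rw [sum_eq_sum_setCoord _ i]
    refine Finset.sum_congr rfl fun y _ => ?_
    by_cases hy : y i = none
    · simp only [hy, if_true, setCoord_setCoord, setCoord_eq_self hy, ← Finset.sum_mul, marginal_eq]
      rw [sum_weight_mul_partialMass_setCoord, setCoord_eq_self hy]
    · simp only [hy, if_false, zero_mul]
  rw [h, h2, sum_ite_setCoord_none, if_pos hxj]
  simp only [setCoord_apply_ne x hij, hxi, if_true]
  have h3 : ∀ b, (∏ l ∈ Finset.univ.erase i, tokWeight (Real.exp (-t)) (setCoord x j b l)) =
      tokWeight (Real.exp (-t)) b *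
        ∏ l ∈ (Finset.univ.erase i).erase j, tokWeight (Real.exp (-t)) (ω l) := fun b => by
    rw [← Finset.mul_prod_erase _ _ (Finset.mem_erase.2 ⟨hij.symm, Finset.mem_univ j⟩)]
    congr 1
    · simp
    · refine Finset.prod_congr rfl fun l hl => ?_
      have h1 := Finset.ne_of_mem_erase hl
      rw [setCoord_apply_ne _ h1, hxl l (Finset.ne_of_mem_erase (Finset.mem_of_mem_erase hl)) h1]
  simp only [h3, mul_right_comm _ _ (partialMass _ _), ← Finset.sum_mul]
  rw [sum_tokWeight_mul_partialMass, setCoord_eq_self hxj, mul_comm]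

/-- The logarithm of the data mass compatible with a state. -/
def logMass (qdata : PMF (Fin d → Fin S)) (x : State d S) : ℝ := Real.log (partialMass qdata x)

/-- The four events fix the state up to none, one or two coordinates, so each probability is a mask
weight times a partial mass, and the weights cancel in the ratio. States of probability zero
contribute nothing, so log 0 does not matter. -/
theorem condMutualInfo_marginal (qdata : PMF (Fin d → Fin S)) {t : ℝ} (ht : 0 ≤ t) {i j : Fin d}
    (hij : i ≠ j) :
    condMutualInfo (marginal qdata t) (fun x : State d S => x i) (fun x => x j)
      (fun x (l : {l : Fin d // l ≠ i ∧ l ≠ j}) => x l) =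
    marginalMean qdata (fun x => logMass qdata (setCoord (setCoord x i none) j none) -
      logMass qdata (setCoord x i none) - (logMass qdata (setCoord x j none) - logMass qdata x)) t
    := by
  have hCiff : ∀ η ω : State d S, ((fun (x : State d S) (l : {l : Fin d // l ≠ i ∧ l ≠ j}) => x l) η =
      (fun (x : State d S) (l : {l : Fin d // l ≠ i ∧ l ≠ j}) => x l) ω) ↔
      ∀ l, l ≠ i → l ≠ j → η l = ω l := fun η ω => by
    rw [funext_iff]
    exact ⟨fun h l h1 h2 => h ⟨l, h1, h2⟩, fun h l => h l.1 l.2.1 l.2.2⟩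
  unfold condMutualInfo marginalMean
  refine Finset.sum_congr rfl fun ω _ => ?_
  rcases (marginal_nonneg qdata ht ω).eq_or_lt with h0 | h0
  · rw [← h0]; simp
  congr 1
  refine Eq.trans (congrArg Real.log (congrArg₂ HDiv.hDiv
    (congrArg₂ HMul.hMul (prob_congr (F := fun η => η = ω) _ ?_)
      (prob_congr (F := fun η : State d S =>
        setCoord (setCoord η i none) j none = setCoord (setCoord ω i none) j none) _ ?_))
    (congrArg₂ HMul.hMul
      (prob_congr (F := fun η : State d S => setCoord η j none = setCoord ω j none) _ ?_)
      (prob_congr (F := fun η : State d S => setCoord η i none = setCoord ω i none) _ ?_)))) ?_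
  rotate_right
  · rw [prob_marginal_setCoord, prob_marginal_setCoord, prob_marginal_setCoord_setCoord _ _ _ hij]
    have e : prob (marginal qdata t) (fun η => η = ω) = marginal qdata t ω := by simp [prob]
    have hi := Finset.mul_prod_erase (Finset.univ.erase j)
      (fun l => tokWeight (Real.exp (-t)) (ω l)) (Finset.mem_erase.2 ⟨hij, Finset.mem_univ i⟩)
    have hj := Finset.mul_prod_erase (Finset.univ.erase i)
      (fun l => tokWeight (Real.exp (-t)) (ω l)) (Finset.mem_erase.2 ⟨hij.symm, Finset.mem_univ j⟩)
    rw [Finset.erase_right_comm] at hi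
    rw [e, ← hi, ← hj]
    rw [marginal_eq] at h0 ⊢
    have hw := weight_eq_mul_erase (Real.exp (-t)) ω i
    rw [← hj] at hw
    have hm : 0 < partialMass qdata ω := pos_of_mul_pos_right h0
      (weight_nonneg (Real.exp_pos _).le (Real.exp_le_one_iff.2 (by linarith)) _)
    have hwne : weight (Real.exp (-t)) ω ≠ 0 := left_ne_zero_of_mul h0.ne'
    have hmi := hm.trans_le (partialMass_setCoord_none_ge qdata ω i)
    have hmj := hm.trans_le (partialMass_setCoord_none_ge qdata ω j)
    have hmij := hmi.trans_le (partialMass_setCoord_none_ge qdata (setCoord ω i none) j)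
    rw [hw] at hwne ⊢
    generalize (∏ l ∈ (Finset.univ.erase i).erase j, tokWeight (Real.exp (-t)) (ω l)) = W at *
    generalize tokWeight (Real.exp (-t)) (ω i) = wi at *
    generalize tokWeight (Real.exp (-t)) (ω j) = wj at *
    have hwi := left_ne_zero_of_mul hwne
    have hwj := left_ne_zero_of_mul (right_ne_zero_of_mul hwne)
    have hW := right_ne_zero_of_mul (right_ne_zero_of_mul hwne)
    unfold logMass
    beta_reduce
    rw [← Real.log_div hmij.ne' hmi.ne', ← Real.log_div hmj.ne' hm.ne',
      ← Real.log_div (div_pos hmij hmi).ne' (div_pos hmj hm).ne']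
    congr 1
    have := hm.ne'
    have := hmi.ne'
    have := hmj.ne'
    field_simp
  · intro η
    rw [hCiff]
    constructor
    · rintro ⟨h1, h2, h3⟩
      funext l
      by_cases hli : l = i
      · rw [hli]; exact h1
      by_cases hlj : l = j
      · rw [hlj]; exact h2
      exact h3 l hli hlj
    · rintro rfl
      exact ⟨rfl, rfl, fun _ _ _ => rfl⟩
  · intro η
    rw [setCoord_none_eq_iff, hCiff]
    refine forall_congr' fun l => ?_
    constructor
    · intro h hl
      by_cases hli : l = i
      · subst hli; simp
      · rw [setCoord_apply_ne _ hli, setCoord_apply_ne _ hli, h hli hl]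
    · intro h h1 h2
      have := h h2
      rwa [setCoord_apply_ne _ h1, setCoord_apply_ne _ h1] at this
  · intro η
    rw [setCoord_none_eq_iff, hCiff]
    constructor
    · rintro ⟨h1, h2⟩ l hl
      by_cases hli : l = i
      · rw [hli]; exact h1
      · exact h2 l hli hl
    · intro h
      exact ⟨h i hij, fun l _ h1 => h l h1⟩
  · intro η
    rw [setCoord_none_eq_iff, hCiff]
    constructor
    · rintro ⟨h1, h2⟩ l hl
      by_cases hlj : l = j
      · rw [hlj]; exact h1
      · exact h2 l hl hlj
    · intro h
      exact ⟨h j hij.symm, fun l h1 _ => h l h1⟩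

/-- The squared generator is the sum of second differences over all pairs. Masking `i` twice is
masking it once, so its diagonal terms are minus first differences, which the added generator
removes. -/
theorem pairInfo_eq (qdata : PMF (Fin d → Fin S)) {t : ℝ} (ht : 0 ≤ t) :
    pairInfo qdata t = marginalMean qdata (generator (generator (logMass qdata))) t +
      marginalMean qdata (generator (logMass qdata)) t := by
  unfold pairInfo
  have h : ∀ i, ∀ j ∈ Finset.univ.erase i, condMutualInfo (marginal qdata t)
      (fun x : State d S => x i) (fun x => x j) (fun x (l : {l : Fin d // l ≠ i ∧ l ≠ j}) => x l) =
      _ := fun i j hj => condMutualInfo_marginal qdata ht (Finset.ne_of_mem_erase hj).symm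
  rw [Finset.sum_congr rfl fun i _ => Finset.sum_congr rfl (h i)]
  simp only [marginalMean]
  rw [← Finset.sum_add_distrib]
  simp only [Finset.sum_comm (t := (Finset.univ : Finset (State d S))), ← Finset.mul_sum,
    ← mul_add]
  refine Finset.sum_congr rfl fun x _ => ?_
  congr 1
  unfold generator
  rw [← Finset.sum_add_distrib]
  refine Finset.sum_congr rfl fun i _ => ?_
  rw [← Finset.sum_sub_distrib, ← Finset.add_sum_erase _ _ (Finset.mem_univ i)]
  simp only [setCoord_setCoord]
  ring

theorem continuous_marginalMean (qdata : PMF (Fin d → Fin S)) (F : State d S → ℝ) :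
    Continuous (marginalMean qdata F) :=
  continuous_iff_continuousAt.2 fun t => (hasDerivAt_marginalMean qdata F t).continuousAt

theorem intervalIntegrable_pairInfo (qdata : PMF (Fin d → Fin S)) {a b : ℝ} (ha : 0 ≤ a)
    (hab : a ≤ b) : IntervalIntegrable (pairInfo qdata) MeasureTheory.volume a b := by
  have h : Continuous fun t => marginalMean qdata (generator (generator (logMass qdata))) t +
      marginalMean qdata (generator (logMass qdata)) t :=
    (continuous_marginalMean _ _).add (continuous_marginalMean _ _)
  refine (h.intervalIntegrable a b).congr ?_
  intro t ht
  rw [Set.uIoc_of_le hab] at ht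
  exact (pairInfo_eq qdata (ha.trans ht.1.le)).symm

/-- Taylor bound for the expected log mass over one step. -/
theorem marginalMean_logMass_step_le (qdata : PMF (Fin d → Fin S)) {a b : ℝ} (ha : 0 ≤ a)
    (hab : a ≤ b) :
    marginalMean qdata (logMass qdata) a - marginalMean qdata (logMass qdata) b +
      (Real.exp (b - a) - 1) * marginalMean qdata (generator (logMass qdata)) b ≤
    (Real.exp (b - a) - 1) * ∫ t in a..b, pairInfo qdata t := by
  -- The factor e^{t-a} - 1 produces M'' + M' on differentiation and vanishes at a, so the increment
  -- over [a, b] is exactly the left-hand side.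
  have hd : ∀ t ∈ Set.uIcc a b, HasDerivAt
      (fun t => (Real.exp (t - a) - 1) * marginalMean qdata (generator (logMass qdata)) t -
        marginalMean qdata (logMass qdata) t) ((Real.exp (t - a) - 1) * pairInfo qdata t) t := by
    intro t ht
    rw [Set.uIcc_of_le hab] at ht
    have h1 : HasDerivAt (fun t => Real.exp (t - a) - 1) (Real.exp (t - a)) t := by
      simpa using (((hasDerivAt_id t).sub_const a).exp).sub_const 1
    refine ((h1.mul (hasDerivAt_marginalMean qdata (generator (logMass qdata)) t)).sub
      (hasDerivAt_marginalMean qdata (logMass qdata) t)).congr_deriv ?_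
    rw [pairInfo_eq qdata (ha.trans ht.1)]
    ring
  have hint := intervalIntegrable_pairInfo qdata ha hab
  have hint' : IntervalIntegrable (fun t => (Real.exp (t - a) - 1) * pairInfo qdata t)
      MeasureTheory.volume a b :=
    hint.continuousOn_mul (by fun_prop)
  have h := intervalIntegral.integral_eq_sub_of_hasDerivAt hd hint'
  simp only [sub_self, Real.exp_zero, zero_mul, zero_sub] at h
  have h2 : marginalMean qdata (logMass qdata) a - marginalMean qdata (logMass qdata) b +
      (Real.exp (b - a) - 1) * marginalMean qdata (generator (logMass qdata)) b =
      ∫ t in a..b, (Real.exp (t - a) - 1) * pairInfo qdata t := by rw [h]; ring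
  rw [h2, ← intervalIntegral.integral_const_mul]
  refine intervalIntegral.integral_mono_on hab hint' (hint.const_mul _) fun t ht => ?_
  refine mul_le_mul_of_nonneg_right ?_ (pairInfo_nonneg qdata (ha.trans ht.1))
  have := Real.exp_le_exp.2 (sub_le_sub_right ht.2 a)
  linarith

/-! ### Relative entropies of laws on finite spaces -/

theorem pmfKL_eq_ofReal {α : Type*} [Fintype α] (p q : PMF α) (h : ∀ x, q x = 0 → p x = 0) :
    pmfKL p q = ENNReal.ofReal (∑ x, (p x).toReal * Real.log ((p x).toReal / (q x).toReal)) := by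
  let _ : MeasurableSpace α := ⊤
  have hd : p.toMeasure = q.toMeasure.withDensity (fun x => p x / q x) := by
    refine MeasureTheory.Measure.ext_of_singleton fun x => ?_
    rw [p.toMeasure_apply_singleton _ (MeasurableSet.singleton x),
      MeasureTheory.withDensity_apply _ (MeasurableSet.singleton x),
      MeasureTheory.lintegral_singleton, q.toMeasure_apply_singleton _ (MeasurableSet.singleton x)]
    rcases eq_or_ne (q x) 0 with h0 | h0
    · simp [h0, h x h0]
    · rw [ENNReal.div_mul_cancel h0 (q.apply_ne_top x)]
  have hac : p.toMeasure.AbsolutelyContinuous q.toMeasure := by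
    rw [hd]; exact MeasureTheory.withDensity_absolutelyContinuous _ _
  have hrn : p.toMeasure.rnDeriv q.toMeasure =ᵐ[p.toMeasure] fun x => p x / q x := by
    have h1 := MeasureTheory.Measure.rnDeriv_withDensity q.toMeasure
      (f := fun x => p x / q x) measurable_from_top
    rw [← hd] at h1
    exact hac.ae_le h1
  unfold pmfKL
  rw [InformationTheory.klDiv_of_ac_of_integrable hac MeasureTheory.Integrable.of_finite]
  simp only [MeasureTheory.probReal_univ, add_sub_cancel_right]
  rw [MeasureTheory.integral_congr_ae (g := fun x => Real.log ((p x).toReal / (q x).toReal)),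
    PMF.integral_eq_sum]
  · simp
  · filter_upwards [hrn] with x hx
    simp only [MeasureTheory.llr, hx, ENNReal.toReal_div]

/-- The log-sum inequality for finite sums. -/
theorem sum_mul_log_div_sum_le {α : Type*} (s : Finset α) (u v : α → ℝ) (hu : ∀ x ∈ s, 0 ≤ u x)
    (hv : ∀ x ∈ s, 0 ≤ v x) (h : ∀ x ∈ s, 0 < u x → 0 < v x) :
    (∑ x ∈ s, u x) * Real.log ((∑ x ∈ s, u x) / ∑ x ∈ s, v x) ≤
      ∑ x ∈ s, u x * Real.log (u x / v x) := by
  rcases (Finset.sum_nonneg hu).eq_or_lt with h0 | h0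
  · rw [← h0, zero_mul]
    refine (Finset.sum_eq_zero fun x hx => ?_).ge
    rw [(Finset.sum_eq_zero_iff_of_nonneg hu).1 h0.symm x hx, zero_mul]
  · obtain ⟨x₀, hx₀, hx₀'⟩ : ∃ x ∈ s, 0 < u x := by
      by_contra hc
      push Not at hc
      exact (Finset.sum_nonpos hc).not_gt h0
    have hV : 0 < ∑ x ∈ s, v x := Finset.sum_pos' hv ⟨x₀, hx₀, h x₀ hx₀ hx₀'⟩
    set U := ∑ x ∈ s, u x with hU
    set V := ∑ x ∈ s, v x with hV'
    -- This is log z ≥ 1 - 1/z at z = (u/v) / (U/V); the corrections sum to U - V (U/V) = 0.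
    have key : ∀ x ∈ s, u x * Real.log (U / V) + (u x - v x * (U / V)) ≤
        u x * Real.log (u x / v x) := fun x hx => by
      rcases (hu x hx).eq_or_lt with h1 | h1
      · rw [← h1]
        have := mul_nonneg (hv x hx) (div_pos h0 hV).le
        simp only [zero_mul, zero_add]
        linarith
      · have hvx := h x hx h1
        have := Real.one_sub_inv_le_log_of_pos (div_pos (div_pos h1 hvx) (div_pos h0 hV))
        rw [Real.log_div (div_pos h1 hvx).ne' (div_pos h0 hV).ne', inv_div] at this
        have h3 := mul_le_mul_of_nonneg_left this h1.le
        have h4 : u x * (U / V / (u x / v x)) = v x * (U / V) := by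
          have := h1.ne'; have := hvx.ne'
          field_simp
        rw [mul_sub, mul_sub, mul_one, h4] at h3
        linarith
    have := Finset.sum_le_sum key
    rw [Finset.sum_add_distrib, Finset.sum_sub_distrib, ← Finset.sum_mul, ← Finset.sum_mul,
      ← hU, ← hV', mul_div_cancel₀ _ hV.ne', sub_self, add_zero] at this
    exact this

theorem one_sub_exp_neg_pos {x : ℝ} (hx : 0 < x) : 0 < 1 - Real.exp (-x) :=
  sub_pos.2 (Real.exp_lt_one_iff.2 (neg_lt_zero.2 hx))

/-- The tangent line inequality for the convex function `x ↦ log ((1 - e⁻ˣ) / x)`. -/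
theorem log_one_sub_exp_neg_div_tangent {x y : ℝ} (hx : 0 < x) (hy : 0 < y) :
    Real.log ((1 - Real.exp (-x)) / x) +
      (y - x) * (Real.exp (-x) / (1 - Real.exp (-x)) - 1 / x) ≤
    Real.log ((1 - Real.exp (-y)) / y) := by
  have hex : 0 < 1 - Real.exp (-x) := one_sub_exp_neg_pos hx
  have hey : 0 < 1 - Real.exp (-y) := one_sub_exp_neg_pos hy
  set c := y - x with hc
  -- The mean of s under the density proportional to e^{-xs} on [0, 1].
  set m := 1 / x - Real.exp (-x) / (1 - Real.exp (-x)) with hm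
  -- An antiderivative of e^{-ys} - e^{-cm} e^{-xs} (1 + c(m - s)), which is nonnegative by e^u ≥ 1
  -- + u. Over [0, 1] the linear correction integrates to zero by the choice of m: this is Jensen's
  -- inequality.
  let A : ℝ → ℝ := fun s => -Real.exp (-(y * s)) / y -
    Real.exp (-(c * m)) * (-Real.exp (-(x * s)) / x * (1 + c * m - c * s) +
      c * (Real.exp (-(x * s)) / x ^ 2))
  have hA : ∀ s, HasDerivAt A (Real.exp (-(y * s)) -
      Real.exp (-(c * m)) * (Real.exp (-(x * s)) * (1 + c * m - c * s))) s := by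
    intro s
    have e : ∀ z : ℝ, HasDerivAt (fun s => Real.exp (-(z * s))) (Real.exp (-(z * s)) * -z) s :=
      fun z => by simpa using (((hasDerivAt_id s).const_mul z).neg).exp
    have l : HasDerivAt (fun s => 1 + c * m - c * s) (-c) s := by
      simpa using ((hasDerivAt_id s).const_mul c).const_sub (1 + c * m)
    refine ((((e y).neg).div_const y).sub ((((((e x).neg).div_const x).mul l).add
      (((e x).div_const (x ^ 2)).const_mul c)).const_mul (Real.exp (-(c * m))))).congr_deriv ?_
    simp only [Pi.neg_apply]
    field_simp
    ring
  have hmono : Monotone A := by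
    refine monotone_of_hasDerivAt_nonneg hA fun s => ?_
    have h1 := Real.add_one_le_exp (c * m - c * s)
    have h2 : Real.exp (-(y * s)) =
        Real.exp (-(c * m)) * (Real.exp (-(x * s)) * Real.exp (c * m - c * s)) := by
      rw [← Real.exp_add, ← Real.exp_add]; congr 1; rw [hc]; ring
    rw [Pi.zero_apply, h2, ← mul_sub, ← mul_sub]
    refine mul_nonneg (Real.exp_pos _).le (mul_nonneg (Real.exp_pos _).le ?_)
    linarith
  have h01 := hmono zero_le_one
  simp only [A, mul_zero, neg_zero, Real.exp_zero, mul_one, sub_zero] at h01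
  have hkey : Real.exp (-(c * m)) * ((1 - Real.exp (-x)) / x) ≤ (1 - Real.exp (-y)) / y := by
    have hm2 : m * (1 - Real.exp (-x)) = (1 - Real.exp (-x)) / x - Real.exp (-x) := by
      rw [hm]; field_simp
    have e1 : (-Real.exp (-x) / x * (1 + c * m - c) + c * (Real.exp (-x) / x ^ 2)) -
        (-1 / x * (1 + c * m) + c * (1 / x ^ 2)) = (1 - Real.exp (-x)) / x := by
      have : (-Real.exp (-x) / x * (1 + c * m - c) + c * (Real.exp (-x) / x ^ 2)) -
        (-1 / x * (1 + c * m) + c * (1 / x ^ 2)) = (1 - Real.exp (-x)) / x +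
          c / x * (m * (1 - Real.exp (-x)) - ((1 - Real.exp (-x)) / x - Real.exp (-x))) := by
        field_simp; ring
      rw [this, hm2]; ring
    rw [← e1]
    have : (1 - Real.exp (-y)) / y = -Real.exp (-y) / y - -1 / y := by ring
    rw [this]
    linarith
  have h := Real.log_le_log (mul_pos (Real.exp_pos _) (div_pos hex hx)) hkey
  rw [Real.log_mul (Real.exp_pos _).ne' (div_pos hex hx).ne', Real.log_exp] at h
  have : c * (Real.exp (-x) / (1 - Real.exp (-x)) - 1 / x) = -(c * m) := by rw [hm]; ring
  rw [this]
  linarith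

/-- Comparison of two exponential clocks stopped at time one. -/
theorem exp_clock_kl_le {x y : ℝ} (hx : 0 < x) (hy : 0 < y) :
    Real.exp (-x) * (y - x) +
      (1 - Real.exp (-x)) * Real.log ((1 - Real.exp (-x)) / (1 - Real.exp (-y))) ≤
    (1 - Real.exp (-x)) * (y / x - 1 - Real.log (y / x)) := by
  have hex : 0 < 1 - Real.exp (-x) := one_sub_exp_neg_pos hx
  have hey : 0 < 1 - Real.exp (-y) := one_sub_exp_neg_pos hy
  have h := mul_le_mul_of_nonneg_left (log_one_sub_exp_neg_div_tangent hx hy) hex.le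
  rw [Real.log_div hex.ne' hx.ne', Real.log_div hey.ne' hy.ne'] at h
  rw [Real.log_div hex.ne' hey.ne', Real.log_div hy.ne' hx.ne']
  have e : (1 - Real.exp (-x)) * ((y - x) * (Real.exp (-x) / (1 - Real.exp (-x)) - 1 / x)) =
      Real.exp (-x) * (y - x) - (1 - Real.exp (-x)) * (y / x - 1) := by
    field_simp
  rw [mul_add, e] at h
  linarith

/-! ### Weighted Bregman divergences -/

theorem weightedBregman_toReal_of_pos {a b : ℝ} (ha : 0 < a) (hb : 0 < b) :
    (weightedBregman a b).toReal = a - b - b * Real.log (a / b) := by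
  have h := Real.log_le_sub_one_of_pos (div_pos ha hb)
  rw [weightedBregman, if_neg hb.ne', if_neg ha.ne', ENNReal.toReal_ofReal, bregman]
  · field_simp
  · refine mul_nonneg hb.le ?_
    unfold bregman; linarith

theorem weightedBregman_zero_toReal {a : ℝ} (ha : 0 ≤ a) : (weightedBregman a 0).toReal = a := by
  simp [weightedBregman, ha]

/-- Decomposition of the score entropy of a vector of rates into the parts of the total rate and
of the normalized rates. -/
theorem sum_weightedBregman {S : ℕ} {r : Fin S → ℝ≥0} {μ : Fin S → ℝ} {s : ℝ} (hs : 0 < s)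
    (hμ : ∀ b, 0 ≤ μ b) (hμ1 : ∑ b, μ b = 1) (hr : ∀ b, 0 < μ b → 0 < r b) :
    ∑ b, (weightedBregman (r b) (s * μ b)).toReal =
      s * ((∑ b, (r b : ℝ)) / s - 1 - Real.log ((∑ b, (r b : ℝ)) / s)) +
      s * ∑ b, μ b * Real.log (μ b / (r b / ∑ b, (r b : ℝ))) := by
  have hR : 0 < ∑ b, (r b : ℝ) := by
    obtain ⟨b, -, hb⟩ : ∃ b ∈ Finset.univ, 0 < μ b := by
      by_contra hc
      push Not at hc
      have := Finset.sum_nonpos hc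
      linarith
    exact Finset.sum_pos' (fun b _ => (r b).coe_nonneg) ⟨b, Finset.mem_univ _, hr b hb⟩
  set R := ∑ b, (r b : ℝ) with hRdef
  have h : ∀ b, (weightedBregman (r b) (s * μ b)).toReal =
      r b - s * μ b - s * μ b * Real.log (R / s) + s * (μ b * Real.log (μ b / (r b / R))) := by
    intro b
    rcases (hμ b).eq_or_lt with h0 | h0
    -- A token of true rate zero costs its whole estimated rate, which completes the sum R.
    · rw [← h0, mul_zero, weightedBregman_zero_toReal (r b).coe_nonneg]; simp
    · have hrb : (0 : ℝ) < r b := hr b h0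
      rw [weightedBregman_toReal_of_pos hrb (mul_pos hs h0)]
      have e : (r b : ℝ) / (s * μ b) = R / s / (μ b / (r b / R)) := by field_simp
      rw [e, Real.log_div (div_pos hR hs).ne' (div_pos h0 (div_pos hrb hR)).ne']
      ring
  rw [Finset.sum_congr rfl fun b _ => h b]
  simp only [Finset.sum_add_distrib, Finset.sum_sub_distrib, ← Finset.mul_sum, ← Finset.sum_mul,
    hμ1, ← hRdef]
  field_simp

/-- The relative entropy of one coordinate of a step is controlled by the score entropy. -/
theorem coordinate_kl_le {S : ℕ} {r : Fin S → ℝ≥0} {μ : Fin S → ℝ} {s l : ℝ} (hs : 0 < s)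
    (hl : 0 < l) (hμ : ∀ b, 0 ≤ μ b) (hμ1 : ∑ b, μ b = 1) (hr : ∀ b, 0 < μ b → 0 < r b)
    {P : ℝ} (hP : P = Real.exp (-((∑ b, (r b : ℝ)) * (l / s)))) :
    Real.exp (-l) * Real.log (Real.exp (-l) / P) +
      ∑ b, (1 - Real.exp (-l)) * μ b *
        Real.log ((1 - Real.exp (-l)) * μ b / ((1 - P) * (r b / ∑ b, (r b : ℝ)))) ≤
    (1 - Real.exp (-l)) / s * ∑ b, (weightedBregman (r b) (s * μ b)).toReal := by
  have hR : 0 < ∑ b, (r b : ℝ) := by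
    obtain ⟨b, -, hb⟩ : ∃ b ∈ Finset.univ, 0 < μ b := by
      by_contra hc
      push Not at hc
      have := Finset.sum_nonpos hc
      linarith
    exact Finset.sum_pos' (fun b _ => (r b).coe_nonneg) ⟨b, Finset.mem_univ _, hr b hb⟩
  rw [sum_weightedBregman hs hμ hμ1 hr]
  set R := ∑ b, (r b : ℝ) with hRdef
  set v := R * (l / s) with hv
  have hvpos : 0 < v := mul_pos hR (div_pos hl hs)
  have hel : 0 < 1 - Real.exp (-l) := one_sub_exp_neg_pos hl
  have hev : 0 < 1 - P := hP ▸ one_sub_exp_neg_pos hvpos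
  have h1 : Real.log (Real.exp (-l) / P) = v - l := by
    rw [hP, ← Real.exp_sub, Real.log_exp]; ring
  have h2 : ∀ b, (1 - Real.exp (-l)) * μ b *
      Real.log ((1 - Real.exp (-l)) * μ b / ((1 - P) * (r b / R))) =
      μ b * ((1 - Real.exp (-l)) * Real.log ((1 - Real.exp (-l)) / (1 - P))) +
      (1 - Real.exp (-l)) * (μ b * Real.log (μ b / (r b / R))) := by
    intro b
    rcases (hμ b).eq_or_lt with h0 | h0
    · rw [← h0]; simp
    · have hrb : (0 : ℝ) < r b := hr b h0
      rw [mul_div_mul_comm, Real.log_mul (div_pos hel hev).ne' (div_pos h0 (div_pos hrb hR)).ne']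
      ring
  rw [h1, Finset.sum_congr rfl fun b _ => h2 b, Finset.sum_add_distrib, ← Finset.sum_mul, hμ1,
    one_mul, ← Finset.mul_sum]
  -- The clocks have rates l and v = R l / s, whose ratio is that of the total rates.
  have h3 := exp_clock_kl_le hl hvpos
  rw [← hP] at h3
  have h4 : v / l = R / s := by rw [hv]; field_simp
  rw [h4] at h3
  rw [mul_add, ← mul_assoc, div_mul_cancel₀ _ hs.ne', ← mul_assoc, div_mul_cancel₀ _ hs.ne']
  linarith

/-- The variant of `coordinate_kl_le` for a step in which every coordinate is unmasked. -/
theorem token_kl_le {S : ℕ} {r : Fin S → ℝ≥0} {μ : Fin S → ℝ} {s : ℝ} (hs : 0 < s)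
    (hμ : ∀ b, 0 ≤ μ b) (hμ1 : ∑ b, μ b = 1) (hr : ∀ b, 0 < μ b → 0 < r b) :
    ∑ b, μ b * Real.log (μ b / (r b / ∑ b, (r b : ℝ))) ≤
    1 / s * ∑ b, (weightedBregman (r b) (s * μ b)).toReal := by
  have hR : 0 < ∑ b, (r b : ℝ) := by
    obtain ⟨b, -, hb⟩ : ∃ b ∈ Finset.univ, 0 < μ b := by
      by_contra hc
      push Not at hc
      have := Finset.sum_nonpos hc
      linarith
    exact Finset.sum_pos' (fun b _ => (r b).coe_nonneg) ⟨b, Finset.mem_univ _, hr b hb⟩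
  rw [sum_weightedBregman hs hμ hμ1 hr, ← mul_add, ← mul_assoc, one_div_mul_cancel hs.ne', one_mul]
  -- With no clock to compare, the nonnegative total-rate part is dropped.
  have := Real.log_le_sub_one_of_pos (div_pos hR hs)
  linarith

/-! ### The reversed noising step -/

/-- The probability that a token `c` becomes the token mask pattern of `b` when a masked token is
revealed with probability `1 - ρ`. -/
def tokReveal (ρ : ℝ) (c b : Token S) : ℝ :=
  if c = none then (if b = none then ρ else 1 - ρ) else if b = c then 1 else 0

theorem tokReveal_nonneg {ρ : ℝ} (h0 : 0 ≤ ρ) (h1 : ρ ≤ 1) (c b : Token S) :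
    0 ≤ tokReveal ρ c b := by
  unfold tokReveal; split_ifs <;> linarith

/-- The joint law of the states `x` at the start and `y` at the end of a reversed noising step. -/
def revealJoint (qdata : PMF (Fin d → Fin S)) (a ρ : ℝ) (x y : State d S) : ℝ :=
  weight a x * ((∏ j, tokReveal ρ (x j) (y j)) * partialMass qdata y)

theorem revealJoint_nonneg (qdata : PMF (Fin d → Fin S)) {a ρ : ℝ} (ha0 : 0 ≤ a) (ha1 : a ≤ 1)
    (h0 : 0 ≤ ρ) (h1 : ρ ≤ 1) (x y : State d S) : 0 ≤ revealJoint qdata a ρ x y :=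
  mul_nonneg (weight_nonneg ha0 ha1 x) (mul_nonneg
    (Finset.prod_nonneg fun _ _ => tokReveal_nonneg h0 h1 _ _) (partialMass_nonneg _ _))

theorem tokReveal_add_tokReveal (ρ : ℝ) (c : Token S) (b : Fin S) :
    tokReveal ρ c none + tokReveal ρ c (some b) = tokCompat b c := by
  cases c with
  | none => simp [tokReveal]
  | some c =>
    simp only [tokReveal, tokCompat_some, reduceCtorEq, if_false, zero_add, Option.some.injEq]
    exact if_congr eq_comm rfl rfl

theorem sum_revealJoint_right (qdata : PMF (Fin d → Fin S)) (a ρ : ℝ) (x : State d S) :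
    ∑ y, revealJoint qdata a ρ x y = weight a x * partialMass qdata x := by
  simp only [revealJoint, ← Finset.mul_sum, mul_comm _ (partialMass qdata _)]
  rw [sum_partialMass_mul_prod qdata fun j c => tokReveal ρ (x j) c]
  simp only [tokReveal_add_tokReveal]
  rw [partialMass, mul_comm]

/-- The other coordinates of `y` sum out to compatibility with `x`. Hence one-coordinate terms see
only the masses of `setCoord x i c`, which is what the score knows. -/
theorem sum_revealJoint_mul (qdata : PMF (Fin d → Fin S)) (a ρ : ℝ) (x : State d S) (i : Fin d)
    (φ : Token S → ℝ) :
    ∑ y, revealJoint qdata a ρ x y * φ (y i) =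
      weight a x * ∑ c, tokReveal ρ (x i) c * partialMass qdata (setCoord x i c) * φ c := by
  have h1 : ∀ y : State d S, (∏ j, tokReveal ρ (x j) (y j)) * φ (y i) =
      ∏ j, (tokReveal ρ (x j) (y j) * if j = i then φ (y j) else 1) := fun y => by
    rw [Finset.prod_mul_distrib, Finset.prod_ite_eq']; simp
  have h2 : ∀ y : State d S, revealJoint qdata a ρ x y * φ (y i) = weight a x *
      (partialMass qdata y * ∏ j, (tokReveal ρ (x j) (y j) * if j = i then φ (y j) else 1)) :=
    fun y => by rw [← h1, revealJoint]; ring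
  simp only [h2, ← Finset.mul_sum]
  congr 1
  rw [sum_partialMass_mul_prod qdata
    fun j c => tokReveal ρ (x j) c * if j = i then φ c else 1]
  simp only [partialMass, Finset.mul_sum, Finset.sum_mul]
  rw [Finset.sum_comm]
  refine Finset.sum_congr rfl fun z _ => ?_
  rw [← Finset.mul_prod_erase _ _ (Finset.mem_univ i)]
  have h3 : ∏ j ∈ Finset.univ.erase i, (tokReveal ρ (x j) none * (if j = i then φ none else 1) +
      tokReveal ρ (x j) (some (z j)) * if j = i then φ (some (z j)) else 1) =
      ∏ j ∈ Finset.univ.erase i, tokCompat (z j) (x j) :=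
    Finset.prod_congr rfl fun j hj => by
      simp [Finset.ne_of_mem_erase hj, tokReveal_add_tokReveal]
  rw [h3]
  simp only [prod_setCoord (fun j c => tokCompat (z j) c), if_true]
  rw [Fintype.sum_option, Finset.sum_eq_single (z i)]
  · simp [tokCompat_some]; ring
  · intro b _ hb; simp [tokCompat_some, hb]
  · simp

/-- Per coordinate, a mask survives with (1 - a) ρ = 1 - a', and a token is present with a + (1 -
a)(1 - ρ) = a'. -/
theorem sum_revealJoint_left (qdata : PMF (Fin d → Fin S)) {a a' ρ : ℝ}
    (h : (1 - a) * ρ = 1 - a') (y : State d S) :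
    ∑ x, revealJoint qdata a ρ x y = weight a' y * partialMass qdata y := by
  simp only [revealJoint, ← mul_assoc, ← Finset.sum_mul]
  congr 1
  simp only [weight, ← Finset.prod_mul_distrib]
  rw [← Fintype.prod_sum (fun j c => tokWeight a c * tokReveal ρ c (y j))]
  refine Finset.prod_congr rfl fun j _ => ?_
  rw [Fintype.sum_option]
  cases hy : y j with
  | none => simpa [tokWeight, tokReveal] using h
  | some b =>
    simp only [tokWeight, tokReveal, if_true, reduceCtorEq, if_false, Option.some.injEq, mul_ite,
      mul_one, mul_zero, Finset.sum_ite_eq, Finset.mem_univ]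
    linarith

/-- A state is compatible with at least as much data as a less masked one. -/
theorem partialMass_le_of_mask (qdata : PMF (Fin d → Fin S)) {x y : State d S}
    (h : ∀ j, x j = none ∨ x j = y j) : partialMass qdata y ≤ partialMass qdata x := by
  refine Finset.sum_le_sum fun z _ => mul_le_mul_of_nonneg_left ?_ ENNReal.toReal_nonneg
  refine Finset.prod_le_prod (fun _ _ => tokCompat_nonneg _ _) fun j _ => ?_
  rcases h j with h | h
  · rw [h]; simpa using tokCompat_le_one _ _
  · rw [h]

theorem eq_none_or_eq_of_tokReveal_ne_zero {ρ : ℝ} {c b : Token S} (h : tokReveal ρ c b ≠ 0) :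
    c = none ∨ c = b := by
  by_contra hc
  push Not at hc
  exact h (by simp [tokReveal, hc.1, hc.2.symm])

/-! ### The chain rule -/

/-- The relative entropy of two mass functions. -/
def relEnt {α : Type*} [Fintype α] (q p : α → ℝ) : ℝ := ∑ x, q x * Real.log (q x / p x)

/-- Forgetting the starting state does not increase relative entropy (log-sum inequality); the joint
relative entropy then splits exactly. -/
theorem relEnt_step_le {α : Type*} [Fintype α] {J P : α → α → ℝ} {p : α → ℝ}
    (hJ : ∀ x y, 0 ≤ J x y) (hp : ∀ x, 0 ≤ p x) (hP : ∀ x y, 0 ≤ P x y)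
    (hsupp : ∀ x y, 0 < J x y → 0 < p x ∧ 0 < P x y) :
    relEnt (fun y => ∑ x, J x y) (fun y => ∑ x, p x * P x y) ≤
      relEnt (fun x => ∑ y, J x y) p +
        ∑ x, ∑ y, J x y * Real.log (J x y / ((∑ y, J x y) * P x y)) := by
  unfold relEnt
  calc _ ≤ ∑ y, ∑ x, J x y * Real.log (J x y / (p x * P x y)) :=
        Finset.sum_le_sum fun y _ => sum_mul_log_div_sum_le Finset.univ (fun x => J x y)
          (fun x => p x * P x y) (fun x _ => hJ x y) (fun x _ => mul_nonneg (hp x) (hP x y))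
          fun x _ h => mul_pos (hsupp x y h).1 (hsupp x y h).2
    _ = _ := by
      rw [Finset.sum_comm, ← Finset.sum_add_distrib]
      refine Finset.sum_congr rfl fun x _ => ?_
      rw [Finset.sum_mul, ← Finset.sum_add_distrib]
      refine Finset.sum_congr rfl fun y _ => ?_
      rcases (hJ x y).eq_or_lt with h0 | h0
      · rw [← h0]; simp
      · obtain ⟨h1, h2⟩ := hsupp x y h0
        have h3 : 0 < ∑ y, J x y := Finset.sum_pos' (fun y _ => hJ x y) ⟨y, Finset.mem_univ _, h0⟩
        rw [← mul_add, ← Real.log_mul (div_pos h3 h1).ne' (div_pos h0 (mul_pos h3 h2)).ne']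
        congr 2
        field_simp

/-- States are grouped by the result `x` of masking `i`. Having a token at `i` instead of the mask
multiplies the weight by e^{-t} / (1 - e^{-t}), the total unmasking rate. -/
theorem marginalMean_generator (qdata : PMF (Fin d → Fin S)) (F : State d S → ℝ) {t : ℝ}
    (ht : 0 < t) :
    marginalMean qdata (generator F) t =
      ∑ i, ∑ x, if x i = none then
        (Real.exp (-t) / (1 - Real.exp (-t))) * weight (Real.exp (-t)) x *
          ∑ b, partialMass qdata (setCoord x i (some b)) * (F x - F (setCoord x i (some b)))
        else 0 := by
  simp only [marginalMean, generator, Finset.mul_sum]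
  rw [Finset.sum_comm]
  refine Finset.sum_congr rfl fun i _ => ?_
  rw [sum_eq_sum_setCoord _ i]
  refine Finset.sum_congr rfl fun x _ => ?_
  split_ifs with hx
  · rw [Fintype.sum_option]
    simp only [setCoord_setCoord, setCoord_eq_self hx, sub_self, mul_zero, zero_add, marginal_eq]
    refine Finset.sum_congr rfl fun b _ => ?_
    have h := one_sub_exp_neg_pos ht
    rw [weight_setCoord, weight_eq_mul_erase _ x i, hx]
    simp only [tokWeight, reduceCtorEq, if_false, if_true]
    field_simp
  · rfl

/-- The relative entropy of a reversed noising step with respect to a product kernel. -/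
theorem sum_revealJoint_log_eq (qdata : PMF (Fin d → Fin S)) {t t' ρ : ℝ} (ht : 0 < t)
    (hρ0 : 0 ≤ ρ) (hρ1 : ρ ≤ 1) (h : (1 - Real.exp (-t)) * ρ = 1 - Real.exp (-t'))
    {A : State d S → Fin d → Token S → ℝ}
    (hsupp : ∀ x y, 0 < revealJoint qdata (Real.exp (-t)) ρ x y → ∀ i, 0 < A x i (y i)) :
    ∑ x, ∑ y, revealJoint qdata (Real.exp (-t)) ρ x y *
      Real.log (revealJoint qdata (Real.exp (-t)) ρ x y /
        ((∑ y, revealJoint qdata (Real.exp (-t)) ρ x y) * ∏ i, A x i (y i))) =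
    marginalMean qdata (logMass qdata) t' - marginalMean qdata (logMass qdata) t +
      ∑ i, ∑ x, weight (Real.exp (-t)) x * ∑ c, tokReveal ρ (x i) c *
        partialMass qdata (setCoord x i c) * Real.log (tokReveal ρ (x i) c / A x i c) := by
  set a := Real.exp (-t) with ha
  have ha0 : 0 < a := Real.exp_pos _
  have ha1 : a < 1 := by have := one_sub_exp_neg_pos ht; linarith
  -- The mask weight cancels: given x, the law of y is m(y) / m(x) times the product of reveal
  -- factors.
  have h1 : ∀ x y, revealJoint qdata a ρ x y * Real.log (revealJoint qdata a ρ x y /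
        ((∑ y, revealJoint qdata a ρ x y) * ∏ i, A x i (y i))) =
      revealJoint qdata a ρ x y * logMass qdata y - revealJoint qdata a ρ x y * logMass qdata x +
        ∑ i, revealJoint qdata a ρ x y * Real.log (tokReveal ρ (x i) (y i) / A x i (y i)) := by
    intro x y
    rcases (revealJoint_nonneg qdata ha0.le ha1.le hρ0 hρ1 x y).eq_or_lt with h0 | h0
    · rw [← h0]; simp
    · have hA := hsupp x y h0
      have hw := weight_pos ha0 ha1 x
      have hRm : (∏ j, tokReveal ρ (x j) (y j)) * partialMass qdata y ≠ 0 :=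
        right_ne_zero_of_mul h0.ne'
      have hR := Finset.prod_ne_zero_iff.1 (left_ne_zero_of_mul hRm)
      have hm := (partialMass_nonneg qdata y).lt_of_ne' (right_ne_zero_of_mul hRm)
      have hmx := hm.trans_le (partialMass_le_of_mask qdata (x := x) fun j =>
        eq_none_or_eq_of_tokReveal_ne_zero (hR j (Finset.mem_univ j)))
      have hRA : ∏ i, (tokReveal ρ (x i) (y i) / A x i (y i)) ≠ 0 :=
        Finset.prod_ne_zero_iff.2 fun i hi => div_ne_zero (hR i hi) (hA i).ne'
      rw [← Finset.mul_sum, ← Real.log_prod fun i hi => div_ne_zero (hR i hi) (hA i).ne',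
        ← mul_sub, ← mul_add, logMass, logMass, ← Real.log_div hm.ne' hmx.ne',
        ← Real.log_mul (div_pos hm hmx).ne' hRA, sum_revealJoint_right, Finset.prod_div_distrib]
      congr 2
      have hAne : ∏ i, A x i (y i) ≠ 0 := Finset.prod_ne_zero_iff.2 fun i _ => (hA i).ne'
      have := hw.ne'
      have := hmx.ne'
      rw [revealJoint]
      field_simp
  have h2 : ∑ x, ∑ y, revealJoint qdata a ρ x y * logMass qdata y =
      marginalMean qdata (logMass qdata) t' := by
    rw [Finset.sum_comm]
    simp only [← Finset.sum_mul, sum_revealJoint_left qdata h, marginalMean, marginal_eq]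
  have h3 : ∑ x, ∑ y, revealJoint qdata a ρ x y * logMass qdata x =
      marginalMean qdata (logMass qdata) t := by
    simp only [← Finset.sum_mul, sum_revealJoint_right, marginalMean, marginal_eq, ha]
  have h4 : ∑ x, ∑ y, ∑ i, revealJoint qdata a ρ x y *
      Real.log (tokReveal ρ (x i) (y i) / A x i (y i)) =
      ∑ i, ∑ x, weight a x * ∑ c, tokReveal ρ (x i) c *
        partialMass qdata (setCoord x i c) * Real.log (tokReveal ρ (x i) c / A x i c) := by
    rw [Finset.sum_comm (s := (Finset.univ : Finset (Fin d)))]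
    refine Finset.sum_congr rfl fun x _ => ?_
    rw [Finset.sum_comm]
    refine Finset.sum_congr rfl fun i _ => ?_
    exact sum_revealJoint_mul qdata a ρ x i fun c => Real.log (tokReveal ρ (x i) c / A x i c)
  simp only [h1, Finset.sum_add_distrib, Finset.sum_sub_distrib]
  rw [h2, h3, h4]

/-- One step of the chain rule: the relative entropy grows by at most the score error `Λ` and the
pairwise information. -/
theorem relEnt_marginal_step_le (qdata : PMF (Fin d → Fin S)) {t t' ρ : ℝ} (ht' : 0 ≤ t')
    (htt' : t' < t) (hρ : ρ = (1 - Real.exp (-t')) / (1 - Real.exp (-t)))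
    {p : State d S → ℝ} {A : State d S → Fin d → Token S → ℝ} {Λ : State d S → Fin d → ℝ}
    (hp : ∀ x, 0 ≤ p x) (hA : ∀ x i c, 0 ≤ A x i c)
    (hAsome : ∀ x i, x i ≠ none → ∀ c, A x i c = if c = x i then 1 else 0)
    (hsupp : ∀ x y, 0 < revealJoint qdata (Real.exp (-t)) ρ x y → 0 < p x ∧ ∀ i, 0 < A x i (y i))
    (hΛ : ∀ x i, 0 < partialMass qdata x → x i = none →
      ρ * Real.log (ρ / A x i none) +
        ∑ b, (1 - ρ) * (partialMass qdata (setCoord x i (some b)) / partialMass qdata x) *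
          Real.log ((1 - ρ) * (partialMass qdata (setCoord x i (some b)) / partialMass qdata x) /
            A x i (some b)) ≤ (Real.exp (t - t') - 1) * Λ x i) :
    relEnt (marginal qdata t') (fun y => ∑ x, p x * ∏ i, A x i (y i)) ≤
      relEnt (marginal qdata t) p +
        (Real.exp (t - t') - 1) * ∑ x, marginal qdata t x * ∑ i, (if x i = none then Λ x i else 0) +
        (Real.exp (t - t') - 1) * ∫ s in t'..t, pairInfo qdata s := by
  have ht : 0 < t := ht'.trans_lt htt'
  have hea := one_sub_exp_neg_pos ht
  have hea' : 0 ≤ 1 - Real.exp (-t') := sub_nonneg.2 (Real.exp_le_one_iff.2 (by linarith))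
  have hlt : Real.exp (-t) < Real.exp (-t') := Real.exp_lt_exp.2 (by linarith)
  have hρ0 : 0 ≤ ρ := hρ ▸ div_nonneg hea' hea.le
  have hρ1 : ρ < 1 := by rw [hρ, div_lt_one hea]; linarith
  have hrel : (1 - Real.exp (-t)) * ρ = 1 - Real.exp (-t') := by
    rw [hρ, mul_div_cancel₀ _ hea.ne']
  have hκ : (Real.exp (t - t') - 1) * (Real.exp (-t) / (1 - Real.exp (-t))) = 1 - ρ := by
    have : Real.exp (-t') = Real.exp (t - t') * Real.exp (-t) := by
      rw [← Real.exp_add]; congr 1; ring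
    rw [hρ, this]
    field_simp
    ring
  have hJ := revealJoint_nonneg qdata (Real.exp_pos (-t)).le (by linarith) hρ0 hρ1.le
  have h1 := relEnt_step_le (J := revealJoint qdata (Real.exp (-t)) ρ)
    (P := fun x y => ∏ i, A x i (y i)) hJ hp (fun x y => Finset.prod_nonneg fun i _ => hA x i _)
    fun x y h => ⟨(hsupp x y h).1, Finset.prod_pos fun i _ => (hsupp x y h).2 i⟩
  rw [sum_revealJoint_log_eq qdata ht hρ0 hρ1.le hrel fun x y h => (hsupp x y h).2] at h1
  simp only [sum_revealJoint_left qdata hrel, sum_revealJoint_right, ← marginal_eq] at h1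
  -- Inserting the exact conditional law of the token splits each logarithm into a one-coordinate
  -- relative entropy, bounded by `hΛ`, and log m(x) - log m(x ⊙_i b), whose sum is the generator
  -- term.
  have h2 : ∀ i x, weight (Real.exp (-t)) x * ∑ c, tokReveal ρ (x i) c *
        partialMass qdata (setCoord x i c) * Real.log (tokReveal ρ (x i) c / A x i c) ≤
      (Real.exp (t - t') - 1) * (marginal qdata t x * if x i = none then Λ x i else 0) +
      (Real.exp (t - t') - 1) * if x i = none then
        (Real.exp (-t) / (1 - Real.exp (-t))) * weight (Real.exp (-t)) x *
          ∑ b, partialMass qdata (setCoord x i (some b)) *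
            (logMass qdata x - logMass qdata (setCoord x i (some b))) else 0 := by
    intro i x
    by_cases hx : x i = none
    · have hle : ∀ b, partialMass qdata (setCoord x i (some b)) ≤ partialMass qdata x := fun b => by
        have := partialMass_setCoord_none_ge qdata (setCoord x i (some b)) i
        rwa [setCoord_setCoord, setCoord_eq_self hx] at this
      rw [if_pos hx, if_pos hx, ← mul_assoc (Real.exp (t - t') - 1) (_ * _), ← mul_assoc
        (Real.exp (t - t') - 1) (_ / _), hκ, marginal_eq]
      rw [mul_left_comm, mul_assoc (weight _ _), mul_comm (1 - ρ) (weight _ _),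
        mul_assoc (weight _ _), ← mul_add]
      refine mul_le_mul_of_nonneg_left ?_ (weight_nonneg (Real.exp_pos _).le (by linarith) _)
      rw [Fintype.sum_option]
      simp only [tokReveal, hx, if_true, reduceCtorEq, if_false, setCoord_eq_self hx]
      rcases (partialMass_nonneg qdata x).eq_or_lt with h0 | h0
      · have : ∀ b, partialMass qdata (setCoord x i (some b)) = 0 := fun b =>
          le_antisymm (h0 ▸ hle b) (partialMass_nonneg _ _)
        simp [← h0, this]
      · have h3 := mul_le_mul_of_nonneg_left (hΛ x i h0 hx) h0.le
        have h4 : ∀ b, (1 - ρ) * partialMass qdata (setCoord x i (some b)) *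
            Real.log ((1 - ρ) / A x i (some b)) =
            partialMass qdata x * ((1 - ρ) *
              (partialMass qdata (setCoord x i (some b)) / partialMass qdata x) *
              Real.log ((1 - ρ) * (partialMass qdata (setCoord x i (some b)) /
                partialMass qdata x) / A x i (some b))) +
            (1 - ρ) * (partialMass qdata (setCoord x i (some b)) *
              (logMass qdata x - logMass qdata (setCoord x i (some b)))) := by
          intro b
          rcases (partialMass_nonneg qdata (setCoord x i (some b))).eq_or_lt with hb | hb
          · rw [← hb]; simp
          · rw [mul_div_right_comm]
            have hAne : A x i (some b) ≠ 0 := by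
              -- A token of positive mass appears at `i` in some `y` of positive joint mass, so
              -- `hsupp` applies.
              have hm0 : (weight (Real.exp (-t)) x *
                  ∑ c, tokReveal ρ (x i) c * partialMass qdata (setCoord x i c) *
                    (if c = some b then 1 else 0)) ≠ 0 := by
                simp only [mul_ite, mul_one, mul_zero, Finset.sum_ite_eq', Finset.mem_univ, if_true]
                refine mul_ne_zero (weight_pos (Real.exp_pos _) (by linarith) x).ne'
                  (mul_ne_zero ?_ hb.ne')
                simp only [tokReveal, hx, if_true, reduceCtorEq, if_false]
                linarith
              rw [← sum_revealJoint_mul qdata _ ρ x i fun c => if c = some b then 1 else 0] at hm0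
              obtain ⟨y, -, hy⟩ := Finset.exists_ne_zero_of_sum_ne_zero hm0
              have hyi : y i = some b := by
                by_contra hc; simp [hc] at hy
              have := (hsupp x y ((hJ x y).lt_of_ne' (left_ne_zero_of_mul hy))).2 i
              rw [hyi] at this
              exact this.ne'
            have hAρ : (1 - ρ) / A x i (some b) ≠ 0 := div_ne_zero (by linarith) hAne
            rw [Real.log_mul hAρ (div_pos hb h0).ne', Real.log_div hb.ne' h0.ne', logMass, logMass]
            field_simp
            ring
        rw [Finset.sum_congr rfl fun b _ => h4 b, Finset.sum_add_distrib, ← Finset.mul_sum,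
          ← Finset.mul_sum]
        linarith
    · rw [if_neg hx, if_neg hx]
      simp only [mul_zero, add_zero]
      refine le_of_eq (mul_eq_zero_of_right _ (Finset.sum_eq_zero fun c _ => ?_))
      rw [hAsome x i hx]
      by_cases hc : c = x i <;> simp [tokReveal, hx, hc]
  have h3 := Finset.sum_le_sum fun i (_ : i ∈ Finset.univ) =>
    Finset.sum_le_sum fun x (_ : x ∈ Finset.univ) => h2 i x
  simp only [Finset.sum_add_distrib, ← Finset.mul_sum] at h3
  rw [← marginalMean_generator qdata (logMass qdata) ht] at h3
  have h4 : ∑ i, ∑ x, marginal qdata t x * (if x i = none then Λ x i else 0) =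
      ∑ x, marginal qdata t x * ∑ i, (if x i = none then Λ x i else 0) := by
    rw [Finset.sum_comm]; simp only [Finset.mul_sum]
  rw [h4] at h3
  have h5 := marginalMean_logMass_step_le qdata ht' htt'.le
  have h6 : relEnt (fun y => marginal qdata t' y) (fun y => ∑ x, p x * ∏ i, A x i (y i)) =
    relEnt (marginal qdata t') (fun y => ∑ x, p x * ∏ i, A x i (y i)) := rfl
  have h7 : relEnt (fun y => marginal qdata t y) p = relEnt (marginal qdata t) p := rfl
  linarith

/-! ### The score entropy loss -/

theorem rateMatrix_setCoord_some (x : State d S) {i : Fin d} (hx : x i = none) (b : Fin S) :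
    rateMatrix d S (setCoord x i (some b)) x = 1 := by
  have hne : setCoord x i (some b) ≠ x := fun h => by
    have := congrFun h i
    rw [setCoord_apply_self, hx] at this
    cases this
  rw [rateMatrix, if_neg hne, offDiagRate_eq, Finset.sum_eq_single i]
  · simp [setCoord_eq_self hx]
  · intro j _ hj
    refine if_neg ?_
    rintro ⟨h1, h2⟩
    rw [setCoord_apply_ne _ hj] at h1
    exact h1 (by rw [h2]; simp)
  · simp

/-- Only the weight at `i` differs, so the total rate does not depend on `x` or `i`, and the rest is
the conditional law of the token. -/
theorem score_setCoord_some (qdata : PMF (Fin d → Fin S)) {t : ℝ} (ht : 0 < t) (x : State d S)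
    {i : Fin d} (hx : x i = none) (b : Fin S) :
    score qdata t (setCoord x i (some b)) x = Real.exp (-t) / (1 - Real.exp (-t)) *
      (partialMass qdata (setCoord x i (some b)) / partialMass qdata x) := by
  have hea := one_sub_exp_neg_pos ht
  have hw := (weight_pos (Real.exp_pos (-t)) (by linarith) x).ne'
  rw [weight_eq_mul_erase _ x i, hx] at hw
  rw [score, marginal_eq, marginal_eq, weight_setCoord, weight_eq_mul_erase _ x i, hx,
    mul_div_mul_comm, mul_div_mul_right _ _ (right_ne_zero_of_mul hw)]
  simp [tokWeight]

/-- The score entropy at the masked coordinate `i` of `x`. -/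
def coordLoss (qdata : PMF (Fin d → Fin S)) (t : ℝ) (shat : State d S → State d S → ℝ≥0)
    (x : State d S) (i : Fin d) : ℝ :=
  ∑ b, (weightedBregman (shat (setCoord x i (some b)) x)
    (score qdata t (setCoord x i (some b)) x)).toReal

theorem coordLoss_nonneg (qdata : PMF (Fin d → Fin S)) (t : ℝ)
    (shat : State d S → State d S → ℝ≥0) (x : State d S) (i : Fin d) :
    0 ≤ coordLoss qdata t shat x i := Finset.sum_nonneg fun _ _ => ENNReal.toReal_nonneg

/-- Filling a masked coordinate of `x` is injective in the coordinate and the token; an inequality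
suffices, so all other `y` are discarded. -/
theorem sum_weightedBregman_le (qdata : PMF (Fin d → Fin S)) (t : ℝ)
    (shat : State d S → State d S → ℝ≥0) (x : State d S) :
    (∑ i, if x i = none then ∑ b, weightedBregman (shat (setCoord x i (some b)) x)
      (score qdata t (setCoord x i (some b)) x) else 0) ≤
    ∑ y ∈ Finset.univ.erase x, ENNReal.ofReal (rateMatrix d S y x) *
      weightedBregman (shat y x) (score qdata t y x) := by
  set F : State d S → ℝ≥0∞ := fun y => ENNReal.ofReal (rateMatrix d S y x) *
      weightedBregman (shat y x) (score qdata t y x) with hF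
  have h1 : (∑ i, if x i = none then ∑ b, weightedBregman (shat (setCoord x i (some b)) x)
      (score qdata t (setCoord x i (some b)) x) else 0) =
      ∑ p ∈ Finset.univ.filter (fun p : Fin d × Fin S => x p.1 = none),
        F (setCoord x p.1 (some p.2)) := by
    rw [Finset.sum_filter, Fintype.sum_prod_type]
    refine Finset.sum_congr rfl fun i _ => ?_
    by_cases hx : x i = none
    · simp [hx, hF, rateMatrix_setCoord_some]
    · simp [hx]
  have hinj : Set.InjOn (fun p : Fin d × Fin S => setCoord x p.1 (some p.2))
      (Finset.univ.filter (fun p : Fin d × Fin S => x p.1 = none)) := by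
    rintro ⟨i, b⟩ hi ⟨j, c⟩ _ h
    simp only [Finset.coe_filter, Finset.mem_univ, true_and, Set.mem_ofPred_eq] at hi
    have h2 := congrFun h i
    simp only [setCoord_apply_self] at h2
    have hij : i = j := by
      by_contra hne
      rw [setCoord_apply_ne _ hne, hi] at h2
      cases h2
    subst hij
    rw [setCoord_apply_self, Option.some.injEq] at h2
    rw [h2]
  rw [h1, ← Finset.sum_image hinj]
  refine Finset.sum_le_sum_of_subset fun y hy => ?_
  obtain ⟨⟨i, b⟩, hp, rfl⟩ := Finset.mem_image.1 hy
  simp only [Finset.mem_filter, Finset.mem_univ, true_and] at hp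
  refine Finset.mem_erase.2 ⟨fun h => ?_, Finset.mem_univ _⟩
  have := congrFun h i
  rw [setCoord_apply_self, hp] at this
  cases this

theorem ofReal_sum_coordLoss_le (qdata : PMF (Fin d → Fin S)) {t : ℝ} (ht : 0 ≤ t)
    (shat : State d S → State d S → ℝ≥0) :
    ENNReal.ofReal (∑ x, marginal qdata t x *
      ∑ i, if x i = none then coordLoss qdata t shat x i else 0) ≤
    scoreEntropyLoss qdata t shat := by
  have h0 : ∀ (x : State d S) (i : Fin d),
      0 ≤ if x i = none then coordLoss qdata t shat x i else 0 := fun x i => by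
    split_ifs
    exacts [coordLoss_nonneg .., le_rfl]
  rw [ENNReal.ofReal_sum_of_nonneg fun x _ =>
    mul_nonneg (marginal_nonneg qdata ht x) (Finset.sum_nonneg fun i _ => h0 x i)]
  refine Finset.sum_le_sum fun x _ => ?_
  rw [ENNReal.ofReal_mul (marginal_nonneg qdata ht x)]
  refine mul_le_mul_right ((le_trans ?_ (sum_weightedBregman_le qdata t shat x))) _
  rw [ENNReal.ofReal_sum_of_nonneg fun i _ => h0 x i]
  refine Finset.sum_le_sum fun i _ => ?_
  split_ifs
  · rw [coordLoss, ENNReal.ofReal_sum_of_nonneg fun _ _ => ENNReal.toReal_nonneg]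
    -- An infinite term becomes zero under `toReal`, harmless in this direction.
    exact Finset.sum_le_sum fun b _ => ENNReal.ofReal_toReal_le
  · simp

/-- A zero estimate of a positive score costs +∞, and `x` has positive probability. This is the
source of absolute continuity. -/
theorem estimate_pos_of_scoreEntropyLoss_ne_top (qdata : PMF (Fin d → Fin S)) {t : ℝ} (ht : 0 < t)
    {shat : State d S → State d S → ℝ≥0} (h : scoreEntropyLoss qdata t shat ≠ ⊤) {x : State d S}
    {i : Fin d} (hi : x i = none) {b : Fin S}
    (hb : 0 < partialMass qdata (setCoord x i (some b))) :
    0 < shat (setCoord x i (some b)) x := by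
  have hea := one_sub_exp_neg_pos ht
  have hmx : 0 < partialMass qdata x := by
    refine hb.trans_le (partialMass_le_of_mask qdata fun j => ?_)
    by_cases hj : j = i
    · subst hj; exact Or.inl hi
    · rw [setCoord_apply_ne _ hj]; exact Or.inr rfl
  have hq : 0 < marginal qdata t x := by
    rw [marginal_eq]
    exact mul_pos (weight_pos (Real.exp_pos _) (by linarith) x) hmx
  have h1 := ENNReal.sum_ne_top.1 h x (Finset.mem_univ x)
  have h2 : (∑ i, if x i = none then ∑ b, weightedBregman (shat (setCoord x i (some b)) x)
      (score qdata t (setCoord x i (some b)) x) else 0) ≠ ⊤ := by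
    refine ne_top_of_le_ne_top ?_ (sum_weightedBregman_le qdata t shat x)
    intro hc
    rw [hc, ENNReal.mul_top (by simpa using hq)] at h1
    exact h1 rfl
  have h3 := ENNReal.sum_ne_top.1 h2 i (Finset.mem_univ i)
  rw [if_pos hi] at h3
  have h4 := ENNReal.sum_ne_top.1 h3 b (Finset.mem_univ b)
  rw [score_setCoord_some qdata ht x hi] at h4
  by_contra hc
  refine h4 ?_
  have hs := mul_pos (div_pos (Real.exp_pos (-t)) hea) (div_pos hb hmx)
  rw [weightedBregman, if_neg hs.ne', if_pos]
  simpa using hc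

/-! ### The sampler -/

/-- The law of the coordinate `i` after step `k`, started from `x`. -/
def stepTokenLaw [NeZero S] (g : TimeGrid) (shat : ℝ → State d S → State d S → ℝ≥0) (k : ℕ)
    (x : State d S) (i : Fin d) : PMF (Token S) :=
  if x i = none then
    maskMix (stayProb g k (estRate g shat k x i)) (stayProb_nonneg _ _ _) (stayProb_le_one _ _ _)
      (tokenLaw (estRate g shat k x i))
  else PMF.pure (x i)

theorem prodLaw_toReal (p : Fin d → PMF (Token S)) (y : State d S) :
    (prodLaw p y).toReal = ∏ i, (p i (y i)).toReal := by
  rw [prodLaw, PMF.ofFintype_apply, ENNReal.toReal_prod]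

theorem stepLaw_toReal [NeZero S] (g : TimeGrid) (shat : ℝ → State d S → State d S → ℝ≥0) (k : ℕ)
    (x y : State d S) :
    (stepLaw g shat k x y).toReal = ∏ i, (stepTokenLaw g shat k x i (y i)).toReal :=
  prodLaw_toReal ..

theorem maskMix_none_toReal {P : ℝ} (h0 : 0 ≤ P) (h1 : P ≤ 1) (ν : PMF (Fin S)) :
    (maskMix P h0 h1 ν none).toReal = P := ENNReal.toReal_ofReal h0

theorem maskMix_some_toReal {P : ℝ} (h0 : 0 ≤ P) (h1 : P ≤ 1) (ν : PMF (Fin S)) (b : Fin S) :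
    (maskMix P h0 h1 ν (some b)).toReal = (1 - P) * (ν b).toReal := by
  change (ENNReal.ofReal (1 - P) * ν b).toReal = _
  rw [ENNReal.toReal_mul, ENNReal.toReal_ofReal (by linarith)]

theorem tokenLaw_toReal [NeZero S] {r : Fin S → ℝ≥0} (h : ∑ b, r b ≠ 0) (b : Fin S) :
    (tokenLaw r b).toReal = r b / ∑ b, (r b : ℝ) := by
  rw [tokenLaw, dif_neg h, PMF.ofFintype_apply, ENNReal.coe_toReal]
  push_cast
  rfl

theorem algLaw_succ_toReal [NeZero S] (g : TimeGrid) (shat : ℝ → State d S → State d S → ℝ≥0)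
    (p0 : PMF (State d S)) (k : ℕ) (y : State d S) :
    (algLaw g shat p0 (k + 1) y).toReal =
      ∑ x, (algLaw g shat p0 k x).toReal * ∏ i, (stepTokenLaw g shat k x i (y i)).toReal := by
  rw [algLaw, PMF.bind_apply, tsum_fintype, ENNReal.toReal_sum]
  · simp only [ENNReal.toReal_mul, stepLaw_toReal]
  · exact fun x _ => ENNReal.mul_ne_top (PMF.apply_ne_top _ _) (PMF.apply_ne_top _ _)

/-- The probability `ρ_k` that the reversed masking process keeps a masked token masked in
step `k`. -/
def TimeGrid.keepProb (g : TimeGrid) (k : ℕ) : ℝ :=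
  (1 - Real.exp (-(g.T - g.t (k + 1)))) / (1 - Real.exp (-(g.T - g.t k)))

theorem TimeGrid.keepProb_eq (g : TimeGrid) (k : ℕ) :
    g.keepProb k = (Real.exp g.T - Real.exp (g.t (k + 1))) / (Real.exp g.T - Real.exp (g.t k)) := by
  have h : ∀ s, Real.exp g.T - Real.exp s = Real.exp g.T * (1 - Real.exp (-(g.T - s))) := fun s => by
    rw [mul_sub, mul_one, ← Real.exp_add]; congr 2; ring
  rw [h, h, mul_div_mul_left _ _ (Real.exp_pos _).ne', keepProb]

theorem TimeGrid.keepProb_pos (g : TimeGrid) {k : ℕ} (hk : k + 1 < g.N) : 0 < g.keepProb k :=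
  div_pos (one_sub_exp_neg_pos (sub_pos.2 (g.t_lt_T hk)))
    (one_sub_exp_neg_pos (sub_pos.2 (g.t_lt_T (by omega))))

theorem TimeGrid.keepProb_lt_one (g : TimeGrid) {k : ℕ} (hk : k < g.N) : g.keepProb k < 1 := by
  have h1 := one_sub_exp_neg_pos (sub_pos.2 (g.t_lt_T hk))
  have h2 : Real.exp (-(g.T - g.t k)) < Real.exp (-(g.T - g.t (k + 1))) :=
    Real.exp_lt_exp.2 (by have := g.t_lt k hk; linarith)
  rw [keepProb, div_lt_one h1]
  linarith

theorem TimeGrid.keepProb_last (g : TimeGrid) {k : ℕ} (hk : k + 1 = g.N) : g.keepProb k = 0 := by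
  have : g.T - g.t (k + 1) = 0 := by rw [hk]; exact sub_self _
  rw [keepProb, this]; simp

/-- The step length is chosen so that rates with the exact total keep a mask with probability
exactly ρ_k. -/
theorem TimeGrid.Delta_eq (g : TimeGrid) {k : ℕ} (hk : k + 1 < g.N) :
    g.Delta k = -Real.log (g.keepProb k) /
      (Real.exp (-(g.T - g.t k)) / (1 - Real.exp (-(g.T - g.t k)))) := by
  have h1 := one_sub_exp_neg_pos (sub_pos.2 (g.t_lt_T (k := k) (by omega)))
  rw [Delta, keepProb_eq, ← Real.log_inv, inv_div]
  have h2 : Real.exp (g.T - g.t k) = (Real.exp (-(g.T - g.t k)))⁻¹ := by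
    rw [← Real.exp_neg, neg_neg]
  rw [h2]
  have := (Real.exp_pos (-(g.T - g.t k))).ne'
  field_simp

/-- The factor (1 - ρ_k) / s of the coordinate bounds thus depends on the step size alone, even near
the end of the run. -/
theorem TimeGrid.exp_h_sub_one (g : TimeGrid) {k : ℕ} (hk : k < g.N) :
    Real.exp (g.h k) - 1 = (1 - g.keepProb k) /
      (Real.exp (-(g.T - g.t k)) / (1 - Real.exp (-(g.T - g.t k)))) := by
  have h1 := one_sub_exp_neg_pos (sub_pos.2 (g.t_lt_T hk))
  have h2 : Real.exp (-(g.T - g.t (k + 1))) = Real.exp (g.h k) * Real.exp (-(g.T - g.t k)) := by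
    rw [← Real.exp_add, TimeGrid.h]; congr 1; ring
  rw [keepProb, h2]
  field_simp
  ring

theorem stepTokenLaw_coordinate_le [NeZero S] (qdata : PMF (Fin d → Fin S)) (g : TimeGrid)
    (shat : ℝ → State d S → State d S → ℝ≥0) {k : ℕ} (hk : k < g.N)
    (hfin : scoreEntropyLoss qdata (g.T - g.t k) (shat (g.T - g.t k)) ≠ ⊤) (x : State d S)
    (i : Fin d) (hx : 0 < partialMass qdata x) (hi : x i = none) :
    g.keepProb k * Real.log (g.keepProb k / (stepTokenLaw g shat k x i none).toReal) +
      ∑ b, (1 - g.keepProb k) * (partialMass qdata (setCoord x i (some b)) / partialMass qdata x) *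
        Real.log ((1 - g.keepProb k) *
          (partialMass qdata (setCoord x i (some b)) / partialMass qdata x) /
            (stepTokenLaw g shat k x i (some b)).toReal) ≤
      (Real.exp (g.h k) - 1) * coordLoss qdata (g.T - g.t k) (shat (g.T - g.t k)) x i := by
  have ht := sub_pos.2 (g.t_lt_T hk)
  have hs := div_pos (Real.exp_pos (-(g.T - g.t k))) (one_sub_exp_neg_pos ht)
  have hμ : ∀ b, 0 ≤ partialMass qdata (setCoord x i (some b)) / partialMass qdata x :=
    fun b => div_nonneg (partialMass_nonneg _ _) hx.le
  have hμ1 : ∑ b, partialMass qdata (setCoord x i (some b)) / partialMass qdata x = 1 := by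
    rw [← Finset.sum_div, sum_partialMass_setCoord_some, setCoord_eq_self hi, div_self hx.ne']
  have hr : ∀ b, 0 < partialMass qdata (setCoord x i (some b)) / partialMass qdata x →
      0 < estRate g shat k x i b := fun b hb =>
    estimate_pos_of_scoreEntropyLoss_ne_top qdata ht hfin hi ((div_pos_iff_of_pos_right hx).1 hb)
  have hr0 : ∑ b, estRate g shat k x i b ≠ 0 := by
    intro hc
    have h0 := Finset.sum_eq_zero_iff.1 hc
    have : ∀ b, partialMass qdata (setCoord x i (some b)) / partialMass qdata x = 0 := fun b => by
      by_contra hb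
      exact (hr b ((hμ b).lt_of_ne' hb)).ne' (h0 b (Finset.mem_univ b))
    simp [this] at hμ1
  have hnone : (stepTokenLaw g shat k x i none).toReal = stayProb g k (estRate g shat k x i) := by
    rw [stepTokenLaw, if_pos hi, maskMix_none_toReal]
  have hsome : ∀ b, (stepTokenLaw g shat k x i (some b)).toReal =
      (1 - stayProb g k (estRate g shat k x i)) *
        (estRate g shat k x i b / ∑ b, (estRate g shat k x i b : ℝ)) := fun b => by
    rw [stepTokenLaw, if_pos hi, maskMix_some_toReal, tokenLaw_toReal hr0]
  have hloss : coordLoss qdata (g.T - g.t k) (shat (g.T - g.t k)) x i =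
      ∑ b, (weightedBregman (estRate g shat k x i b)
        (Real.exp (-(g.T - g.t k)) / (1 - Real.exp (-(g.T - g.t k))) *
          (partialMass qdata (setCoord x i (some b)) / partialMass qdata x))).toReal :=
    Finset.sum_congr rfl fun b _ => by rw [score_setCoord_some qdata ht x hi]; rfl
  simp only [hnone, hsome]
  rw [hloss, g.exp_h_sub_one hk]
  by_cases hN : k + 1 < g.N
  · have hρ := g.keepProb_pos hN
    have hl : 0 < -Real.log (g.keepProb k) := by
      have := Real.log_neg hρ (g.keepProb_lt_one hk); linarith
    have hel : Real.exp (- -Real.log (g.keepProb k)) = g.keepProb k := by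
      rw [neg_neg, Real.exp_log hρ]
    have := coordinate_kl_le hs hl hμ hμ1 hr
      (P := stayProb g k (estRate g shat k x i)) (by
        rw [stayProb, if_pos hN, ← g.Delta_eq hN, neg_mul])
    rwa [hel] at this
  -- In the last step ρ = 0 removes the mask term, and only token laws are compared.
  · have hρ := g.keepProb_last (k := k) (by omega)
    have hP : stayProb g k (estRate g shat k x i) = 0 := by rw [stayProb, if_neg hN]
    rw [hρ, hP]
    simpa using token_kl_le hs hμ hμ1 hr

/-- A mask survives in the reversed process only before the last step, where P is an exponential; a
revealed token has a positive estimate because the loss is finite. -/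
theorem stepTokenLaw_pos [NeZero S] (qdata : PMF (Fin d → Fin S)) (g : TimeGrid)
    (shat : ℝ → State d S → State d S → ℝ≥0) {k : ℕ} (hk : k < g.N)
    (hfin : scoreEntropyLoss qdata (g.T - g.t k) (shat (g.T - g.t k)) ≠ ⊤) {x y : State d S}
    (h : 0 < revealJoint qdata (Real.exp (-(g.T - g.t k))) (g.keepProb k) x y) (i : Fin d) :
    0 < (stepTokenLaw g shat k x i (y i)).toReal := by
  have ht := sub_pos.2 (g.t_lt_T hk)
  have hRm := right_ne_zero_of_mul h.ne'
  have hR := fun j => Finset.prod_ne_zero_iff.1 (left_ne_zero_of_mul hRm) j (Finset.mem_univ j)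
  have hm := (partialMass_nonneg qdata y).lt_of_ne' (right_ne_zero_of_mul hRm)
  have hxy := fun j => eq_none_or_eq_of_tokReveal_ne_zero (hR j)
  by_cases hi : x i = none
  · rw [stepTokenLaw, if_pos hi]
    cases hy : y i with
    | none =>
      have hρ : g.keepProb k ≠ 0 := by
        have := hR i
        rwa [hy, hi, tokReveal, if_pos rfl, if_pos rfl] at this
      have hN : k + 1 < g.N := by
        by_contra hc
        exact hρ (g.keepProb_last (by omega))
      rw [maskMix_none_toReal, stayProb, if_pos hN]
      exact Real.exp_pos _
    | some b =>
      have hr : 0 < estRate g shat k x i b := by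
        refine estimate_pos_of_scoreEntropyLoss_ne_top qdata ht hfin hi
          (hm.trans_le (partialMass_le_of_mask qdata fun j => ?_))
        by_cases hj : j = i
        · subst hj; rw [setCoord_apply_self, hy]; exact Or.inr rfl
        · rw [setCoord_apply_ne _ hj]; exact hxy j
      have hr0 : ∑ b, estRate g shat k x i b ≠ 0 := fun hc =>
        hr.ne' (Finset.sum_eq_zero_iff.1 hc b (Finset.mem_univ b))
      have hR : 0 < ∑ b, (estRate g shat k x i b : ℝ) :=
        Finset.sum_pos' (fun b _ => NNReal.coe_nonneg _) ⟨b, Finset.mem_univ b, hr⟩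
      rw [maskMix_some_toReal, tokenLaw_toReal hr0]
      refine mul_pos ?_ (div_pos hr hR)
      rw [stayProb]
      split_ifs with hN
      · rw [neg_mul]
        refine one_sub_exp_neg_pos (mul_pos hR ?_)
        rw [g.Delta_eq hN]
        refine div_pos ?_ (div_pos (Real.exp_pos _) (one_sub_exp_neg_pos ht))
        have := Real.log_neg (g.keepProb_pos hN) (g.keepProb_lt_one hk)
        linarith
      · norm_num
  · rw [stepTokenLaw, if_neg hi, (hxy i).resolve_left hi]
    simp

/-! ### The initial law -/

theorem initLaw_toReal [NeZero S] (g : TimeGrid) (x : State d S) :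
    (initLaw d S g x).toReal =
      weight (Real.exp (-g.T)) x * ∏ i, if x i = none then 1 else (S : ℝ)⁻¹ := by
  rw [weight, ← Finset.prod_mul_distrib]
  refine (prodLaw_toReal ..).trans (Finset.prod_congr rfl fun i _ => ?_)
  cases hx : x i with
  | none => rw [maskMix_none_toReal]; simp [tokWeight]
  | some b => rw [maskMix_some_toReal]; simp [tokWeight]

theorem sum_marginal_mul_unmasked (qdata : PMF (Fin d → Fin S)) (t : ℝ) (i : Fin d) :
    ∑ x, marginal qdata t x * (if x i = none then 0 else 1) = Real.exp (-t) := by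
  have h1 : ∀ x : State d S, marginal qdata t x * (if x i = none then 0 else 1) =
      partialMass qdata x * ∏ j, (tokWeight (Real.exp (-t)) (x j) *
        if j = i then (if x j = none then 0 else 1) else 1) := fun x => by
    rw [Finset.prod_mul_distrib, Finset.prod_ite_eq', if_pos (Finset.mem_univ i), marginal_eq,
      weight]
    ring
  simp only [h1]
  rw [sum_partialMass_mul_prod qdata fun j c => tokWeight (Real.exp (-t)) c *
        if j = i then (if c = none then 0 else 1) else 1]
  have h2 : ∀ z : Fin d → Fin S, ∏ j, (tokWeight (Real.exp (-t)) (none : Token S) *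
      (if j = i then (if (none : Token S) = none then 0 else 1) else 1) +
      tokWeight (Real.exp (-t)) (some (z j)) *
        if j = i then (if some (z j) = none then 0 else 1) else 1) = Real.exp (-t) := fun z => by
    rw [Finset.prod_eq_single i]
    · simp [tokWeight]
    · intro j _ hj; simp [tokWeight, hj]
    · simp
  rw [Finset.sum_congr rfl fun z _ => congrArg _ (h2 z), ← Finset.sum_mul, sum_toReal_pmf, one_mul]

/-- Both laws have the same mask pattern, so the log ratio is log m(x) plus log S per unmasked
coordinate. The first is nonpositive, and d e^{-T} coordinates are unmasked on average. -/
theorem relEnt_initLaw_le [NeZero S] (qdata : PMF (Fin d → Fin S)) (g : TimeGrid) :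
    relEnt (marginal qdata g.T) (fun x => (initLaw d S g x).toReal) ≤
      Real.exp (-g.T) * d * Real.log S := by
  have hT := g.T_nonneg
  have hS : (0 : ℝ) < S := Nat.cast_pos.2 (NeZero.pos S)
  calc relEnt (marginal qdata g.T) (fun x => (initLaw d S g x).toReal)
      ≤ ∑ x, marginal qdata g.T x * ∑ i, (if x i = none then 0 else 1) * Real.log S := by
        refine Finset.sum_le_sum fun x _ => ?_
        rcases (marginal_nonneg qdata hT x).eq_or_lt with h0 | h0
        · rw [← h0]; simp
        refine mul_le_mul_of_nonneg_left ?_ h0.le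
        have h1 := h0.ne'
        rw [marginal_eq] at h1
        have hm := (partialMass_nonneg qdata x).lt_of_ne' (right_ne_zero_of_mul h1)
        beta_reduce
        rw [initLaw_toReal, marginal_eq, mul_div_mul_left _ _ (left_ne_zero_of_mul h1)]
        have hpos : ∀ i ∈ Finset.univ, (if x i = none then 1 else (S : ℝ)⁻¹) ≠ 0 := fun i _ => by
          split_ifs
          exacts [one_ne_zero, (inv_pos.2 hS).ne']
        rw [Real.log_div hm.ne' (Finset.prod_ne_zero_iff.2 hpos), Real.log_prod hpos]
        have h2 := Real.log_nonpos hm.le (partialMass_le_one qdata x)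
        have h3 : ∑ i, Real.log (if x i = none then 1 else (S : ℝ)⁻¹) =
            -∑ i, (if x i = none then 0 else 1) * Real.log S := by
          rw [← Finset.sum_neg_distrib]
          refine Finset.sum_congr rfl fun i _ => ?_
          split_ifs <;> simp [Real.log_inv]
        rw [h3]
        linarith
    _ = Real.exp (-g.T) * d * Real.log S := by
        simp only [← Finset.sum_mul, ← mul_assoc, Finset.mul_sum]
        rw [Finset.sum_comm]
        simp only [sum_marginal_mul_unmasked]
        rw [Finset.sum_const, Finset.card_univ, Fintype.card_fin, nsmul_eq_mul, mul_comm (d : ℝ)]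

/-! ### Convergence -/

/-- Positivity is carried through the induction because the chain rule needs it at each step. It
starts since T > 0 makes the initial law charge every state. -/
theorem marginal_pos_algLaw_pos_and_relEnt_le [NeZero S] (qdata : PMF (Fin d → Fin S))
    (g : TimeGrid) (shat : ℝ → State d S → State d S → ℝ≥0)
    (hfin : ∀ k < g.N, scoreEntropyLoss qdata (g.T - g.t k) (shat (g.T - g.t k)) ≠ ⊤) {k : ℕ}
    (hk : k ≤ g.N) :
    (∀ x, 0 < marginal qdata (g.T - g.t k) x → 0 < (algLaw g shat (initLaw d S g) k x).toReal) ∧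
    relEnt (marginal qdata (g.T - g.t k)) (fun x => (algLaw g shat (initLaw d S g) k x).toReal) ≤
      Real.exp (-g.T) * d * Real.log S + ∑ j ∈ Finset.range k, (Real.exp (g.h j) - 1) *
        ((∑ x, marginal qdata (g.T - g.t j) x * ∑ i,
          if x i = none then coordLoss qdata (g.T - g.t j) (shat (g.T - g.t j)) x i else 0) +
        ∫ t in (g.T - g.t (j + 1))..(g.T - g.t j), pairInfo qdata t) := by
  induction k with
  | zero =>
    rw [g.t_zero, sub_zero]
    refine ⟨fun x _ => ?_, by simpa [algLaw] using relEnt_initLaw_le qdata g⟩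
    have hT : 0 < g.T := by simpa [g.t_zero] using g.t_lt_T g.N_pos
    rw [algLaw, initLaw_toReal]
    refine mul_pos (weight_pos (Real.exp_pos _) (by have := one_sub_exp_neg_pos hT; linarith) x)
      (Finset.prod_pos fun i _ => ?_)
    have hS : (0 : ℝ) < S := Nat.cast_pos.2 (NeZero.pos S)
    split_ifs
    exacts [one_pos, inv_pos.2 hS]
  | succ k ih =>
    have hkN : k < g.N := hk
    obtain ⟨ih1, ih2⟩ := ih hkN.le
    have hlt := g.t_lt k hkN
    have hτ' : 0 ≤ g.T - g.t (k + 1) := sub_nonneg.2 (g.t_le hk le_rfl)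
    have hτ : 0 < g.T - g.t k := sub_pos.2 (g.t_lt_T hkN)
    have hh : g.T - g.t k - (g.T - g.t (k + 1)) = g.h k := by rw [TimeGrid.h]; ring
    have hea := one_sub_exp_neg_pos hτ
    have hrel : (1 - Real.exp (-(g.T - g.t k))) * g.keepProb k =
        1 - Real.exp (-(g.T - g.t (k + 1))) := by
      rw [TimeGrid.keepProb, mul_div_cancel₀ _ hea.ne']
    have hρ0 : 0 ≤ g.keepProb k :=
      div_nonneg (sub_nonneg.2 (Real.exp_le_one_iff.2 (by linarith))) hea.le
    have hJ := revealJoint_nonneg qdata (Real.exp_pos (-(g.T - g.t k))).le (by linarith) hρ0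
      (g.keepProb_lt_one hkN).le
    have hsupp : ∀ x y, 0 < revealJoint qdata (Real.exp (-(g.T - g.t k))) (g.keepProb k) x y →
        0 < (algLaw g shat (initLaw d S g) k x).toReal ∧
          ∀ i, 0 < (stepTokenLaw g shat k x i (y i)).toReal := fun x y h => by
      refine ⟨ih1 x ?_, stepTokenLaw_pos qdata g shat hkN (hfin k hkN) h⟩
      rw [marginal_eq, ← sum_revealJoint_right qdata _ (g.keepProb k)]
      exact Finset.sum_pos' (fun y _ => hJ x y) ⟨y, Finset.mem_univ y, h⟩
    constructor
    · intro y hy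
      rw [marginal_eq, ← sum_revealJoint_left qdata hrel] at hy
      obtain ⟨x, -, hx⟩ := Finset.exists_ne_zero_of_sum_ne_zero hy.ne'
      obtain ⟨h1, h2⟩ := hsupp x y ((hJ x y).lt_of_ne' hx)
      rw [algLaw_succ_toReal]
      exact Finset.sum_pos' (fun x _ => mul_nonneg ENNReal.toReal_nonneg
        (Finset.prod_nonneg fun _ _ => ENNReal.toReal_nonneg))
        ⟨x, Finset.mem_univ x, mul_pos h1 (Finset.prod_pos fun i _ => h2 i)⟩
    · have h := relEnt_marginal_step_le qdata hτ' (by linarith) (rfl : g.keepProb k = _)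
        (p := fun x => (algLaw g shat (initLaw d S g) k x).toReal)
        (A := fun x i c => (stepTokenLaw g shat k x i c).toReal)
        (Λ := coordLoss qdata (g.T - g.t k) (shat (g.T - g.t k)))
        (fun _ => ENNReal.toReal_nonneg) (fun _ _ _ => ENNReal.toReal_nonneg)
        (fun x i hi c => by
          rw [stepTokenLaw, if_neg hi, PMF.pure_apply]; split_ifs <;> simp)
        hsupp (fun x i hx hi => by
          rw [hh]; exact stepTokenLaw_coordinate_le qdata g shat hkN (hfin k hkN) x i hx hi)
      simp only [algLaw_succ_toReal]
      rw [hh] at h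
      rw [Finset.sum_range_succ, mul_add]
      linarith

theorem TimeGrid.h_pos (g : TimeGrid) {k : ℕ} (hk : k < g.N) : 0 < g.h k :=
  sub_pos.2 (g.t_lt k hk)

theorem ScoreErrorLE.scoreEntropyLoss_ne_top {qdata : PMF (Fin d → Fin S)} {g : TimeGrid}
    {shat : ℝ → State d S → State d S → ℝ≥0} {ε : ℝ} (h : ScoreErrorLE qdata g shat ε) {k : ℕ}
    (hk : k < g.N) : scoreEntropyLoss qdata (g.T - g.t k) (shat (g.T - g.t k)) ≠ ⊤ := by
  have h1 := ENNReal.sum_ne_top.1 (ne_top_of_le_ne_top ENNReal.ofReal_ne_top h) k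
    (Finset.mem_range.2 hk)
  intro hc
  rw [hc, ENNReal.mul_top (by simpa using g.h_pos hk)] at h1
  exact h1 rfl

theorem ScoreErrorLE.sum_coordLoss_le {qdata : PMF (Fin d → Fin S)} {g : TimeGrid}
    {shat : ℝ → State d S → State d S → ℝ≥0} {ε : ℝ} (hε : 0 ≤ ε)
    (h : ScoreErrorLE qdata g shat ε) :
    ∑ k ∈ Finset.range g.N, g.h k * ∑ x, marginal qdata (g.T - g.t k) x * ∑ i,
      (if x i = none then coordLoss qdata (g.T - g.t k) (shat (g.T - g.t k)) x i else 0) ≤ ε := by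
  rw [← ENNReal.ofReal_le_ofReal_iff hε]
  refine le_trans ?_ h
  have hT : ∀ k ∈ Finset.range g.N, 0 ≤ g.T - g.t k := fun k hk =>
    (sub_pos.2 (g.t_lt_T (Finset.mem_range.1 hk))).le
  rw [ENNReal.ofReal_sum_of_nonneg]
  · refine Finset.sum_le_sum fun k hk => ?_
    rw [ENNReal.ofReal_mul (g.h_pos (Finset.mem_range.1 hk)).le]
    exact mul_le_mul_right (ofReal_sum_coordLoss_le qdata (hT k hk) _) _
  · refine fun k hk => mul_nonneg (g.h_pos (Finset.mem_range.1 hk)).le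
      (Finset.sum_nonneg fun x _ => mul_nonneg (marginal_nonneg qdata (hT k hk) x)
        (Finset.sum_nonneg fun i _ => ?_))
    split_ifs
    exacts [coordLoss_nonneg .., le_rfl]

/-- From e^{-h} ≥ 1 - h follows e^h - 1 ≤ h e^h. -/
theorem exp_sub_one_le {h Δ : ℝ} (h0 : 0 ≤ h) (hΔ : h ≤ Δ) :
    Real.exp h - 1 ≤ Real.exp |Δ| * h := by
  have h1 := Real.add_one_le_exp (-h)
  have h2 : Real.exp h * Real.exp (-h) = 1 := by rw [← Real.exp_add]; simp
  have h3 : Real.exp h ≤ Real.exp |Δ| := Real.exp_le_exp.2 (hΔ.trans (le_abs_self Δ))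
  nlinarith [Real.exp_pos h]

end MaskingDiffusion

end

open MaskingDiffusion in
theorem theorem3 (Δ₀ : ℝ) :
    ∃ C : ℝ, 0 < C ∧
      ∀ (d S : ℕ) [NeZero S] (qdata : PMF (Fin d → Fin S)) (g : TimeGrid)
        (shat : ℝ → State d S → State d S → ℝ≥0) (ε : ℝ),
        (∀ k < g.N, g.h k ≤ Δ₀) → 0 ≤ ε → ScoreErrorLE qdata g shat ε →
        (∀ k < g.N, IntervalIntegrable (pairInfo qdata) MeasureTheory.volume
          (g.T - g.t (k + 1)) (g.T - g.t k)) ∧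
        pmfKL (embedData qdata) (outputLaw g shat (initLaw d S g)) ≤
          ENNReal.ofReal (C * (ε + Real.exp (-g.T) * d * Real.log S +
            ∑ k ∈ Finset.range g.N,
              g.h k * ∫ t in (g.T - g.t (k + 1))..(g.T - g.t k), pairInfo qdata t)) := by
  -- The absolute value makes the constant at least one, as needed for the initial term, which
  -- carries no factor e^h - 1.
  refine ⟨Real.exp |Δ₀|, Real.exp_pos _, fun d S _ qdata g shat ε hh hε hscore => ⟨?_, ?_⟩⟩
  · exact fun k hk => intervalIntegrable_pairInfo qdata (sub_nonneg.2 (g.t_le hk le_rfl))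
      (by have := g.t_lt k hk; linarith)
  · obtain ⟨hac, hle⟩ := marginal_pos_algLaw_pos_and_relEnt_le qdata g shat
      (fun k hk => hscore.scoreEntropyLoss_ne_top hk) le_rfl
    have hT : g.T - g.t g.N = 0 := sub_self _
    have hq : marginal qdata 0 = fun x => (embedData qdata x).toReal :=
      funext (marginal_zero qdata)
    rw [hT, hq] at hac hle
    rw [pmfKL_eq_ofReal]
    · refine ENNReal.ofReal_le_ofReal (hle.trans ?_)
      have hstep : ∀ j ∈ Finset.range g.N, (Real.exp (g.h j) - 1) *
          ((∑ x, marginal qdata (g.T - g.t j) x * ∑ i,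
            if x i = none then coordLoss qdata (g.T - g.t j) (shat (g.T - g.t j)) x i else 0) +
          ∫ t in (g.T - g.t (j + 1))..(g.T - g.t j), pairInfo qdata t) ≤
          Real.exp |Δ₀| * (g.h j * (∑ x, marginal qdata (g.T - g.t j) x * ∑ i,
            if x i = none then coordLoss qdata (g.T - g.t j) (shat (g.T - g.t j)) x i else 0) +
          g.h j * ∫ t in (g.T - g.t (j + 1))..(g.T - g.t j), pairInfo qdata t) := by
        intro j hj
        have hj' := Finset.mem_range.1 hj
        rw [← mul_add, ← mul_assoc]
        refine mul_le_mul_of_nonneg_right (exp_sub_one_le (g.h_pos hj').le (hh j hj')) ?_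
        have hτ' : 0 ≤ g.T - g.t (j + 1) := sub_nonneg.2 (g.t_le hj' le_rfl)
        have hlt := g.t_lt j hj'
        refine add_nonneg (Finset.sum_nonneg fun x _ => mul_nonneg
          (marginal_nonneg qdata (by linarith) x) (Finset.sum_nonneg fun i _ => ?_))
          (intervalIntegral.integral_nonneg (by linarith) fun t ht =>
            pairInfo_nonneg qdata (hτ'.trans ht.1))
        split_ifs
        exacts [coordLoss_nonneg .., le_rfl]
      have hsum := Finset.sum_le_sum hstep
      rw [← Finset.mul_sum, Finset.sum_add_distrib] at hsum
      have hloss := hscore.sum_coordLoss_le hε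
      have hC : 1 ≤ Real.exp |Δ₀| := Real.one_le_exp (abs_nonneg _)
      have hinit : 0 ≤ Real.exp (-g.T) * d * Real.log S :=
        mul_nonneg (mul_nonneg (Real.exp_pos _).le (Nat.cast_nonneg d))
          (Real.log_nonneg (Nat.one_le_cast.2 (NeZero.one_le)))
      have h1 := mul_le_mul_of_nonneg_left hloss (Real.exp_pos |Δ₀|).le
      have h2 := mul_le_mul_of_nonneg_right hC hinit
      rw [mul_add] at hsum
      rw [mul_add, mul_add]
      linarith
    · intro x hx
      by_contra hc
      have := hac x (ENNReal.toReal_pos hc (PMF.apply_ne_top _ _))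
      change algLaw g shat (initLaw d S g) g.N x = 0 at hx
      rw [hx] at this
      simp at this
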